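/- Let $B$ be a unital complex algebra. **Bimodules.** A $B$-$B$-bimodule with a specified $B$-projection is $\mathcal X=B\oplus\mathcal X^\circ$ with $\mathcal X^\circ$ a $B$-$B$-bimodule and $p:\mathcal X\to B$ the projection. $\mathcal L(\mathcal X)$ is the algebra of complex linear maps on $\mathcal X$, $E_{\mathcal L(\mathcal X)}(T)=p(T1_B)$, $L_b$ and $R_b$ are left and right multiplication by $b$, and $\mathcal L_\ell(\mathcal X)$, $\mathcal L_r(\mathcal X)$ are the commutants of all $R_b$, respectively all $L_b$. The reduced free product of $(\mathcal X_k)_{k\in K}$ is $\mathcal X=B\oplus\bigoplus_{n\ge1}\bigoplus_{k_1\ne\cdots\ne k_n}\mathcal X_{k_1}^\circ\otimes_B\cdots\otimes_B\mathcal X_{k_n}^\circ$, with left and right regular representations $\lambda_k$ of $\mathcal L_\ell(\mathcal X_k)$ and $\rho_k$ of $\mathcal L_r(\mathcal X_k)$ on $\mathcal X$ (acting on a first, respectively last, tensor factor from $\mathcal X_k$), and $P_k$ the projection of $\mathcal X$ onto $B\oplus\mathcal X_k^\circ$. **Spaces and faces.** A $B$-$B$-non-commutative probability space is $(\mathcal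 A,E,\varepsilon)$ with $\mathcal A$ a unital complex algebra, $\varepsilon:B\otimes B^{\rm op}\to\mathcal A$ a unital homomorphism injective on $B\otimes1$ and on $1\otimes B^{\rm op}$, and $E:\mathcal A\to B$ linear with $E(L_{b_1}R_{b_2}T)=b_1E(T)b_2$ and $E(TL_b)=E(TR_b)$, where $L_b=\varepsilon(b\otimes1)$, $R_b=\varepsilon(1\otimes b)$. $\mathcal A_\ell$, $\mathcal A_r$ are the commutants of all $R_b$, respectively all $L_b$. A pair of $B$-faces is a pair of unital subalgebras $(C,D)$ with $L_B\subseteq C\subseteq\mathcal A_\ell$ and $R_B\subseteq D\subseteq\mathcal A_r$; a triple of $B$-faces is $(A^\ell,A^r,A^b)$ with $(A^\ell,A^r)$ a pair of $B$-faces and $A^b$ a (not necessarily unital) subalgebra with $L_BA^bL_B\subseteq A^b\subseteq\mathcal A_\ell$. Pairs $(C_k,D_k)_{k\in K}$ of $B$-faces are bi-free over $B$ if there are $\mathcal X_k$ and unital homomorphisms $\ell_k:C_k\to\mathcal L_\ell(\mathcal X_k)$, $r_k:D_k\to\mathcal L_r(\mathcal X_k)$ such that the joint moments of the family equal those of $(\lambda_k\ell_k(C_k),\rho_kr_k(D_k))_{k\in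 K}$ in $\mathcal L(\mathcal X)$. Triples $(A_k^\ell,A_k^r,A_k^b)_{k\in K}$ of $B$-faces are free-free-Boolean independent over $B$ if there are $\mathcal X_k$, unital homomorphisms $\ell_k:A_k^\ell\to\mathcal L_\ell(\mathcal X_k)$, $r_k:A_k^r\to\mathcal L_r(\mathcal X_k)$ and homomorphisms $m_k:A_k^b\to\mathcal L(\mathcal X_k)$ such that the joint moments equal those of $(\lambda_k\ell_k(A^\ell_k),\rho_kr_k(A^r_k),P_k\lambda_k(m_k(A^b_k))P_k)_{k\in K}$ in $\mathcal L(\mathcal X)$. (Here $P_k\lambda_k(T)P_k$ is $T$ on $\mathcal X_k=P_k\mathcal X$ and $0$ on the other summands, for every $T\in\mathcal L(\mathcal X_k)$.) **Bi-free ffb $B$-systems.** Pairs of $B$-faces $(A_k^\ell,A_k^r)$ and subsets $C_k',D_k'\subseteq\mathcal A$ form a bi-free ffb $B$-system if there are subalgebras $C_k\supseteq C_k'$ and $D_k\supseteq D_k'$ such that the pairs $(\mathrm{alg}(A_k^\ell,C_k),\mathrm{alg}(A_k^r,D_k))_{k\in K}$ are bi-free over $B$, $D_k'\subseteq\mathcal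 A_\ell$, $L_bC_k'\subseteq C_k'$ and $C_k'L_b\subseteq C_k'$ for all $b\in B$, and, with $\mathbb A_k=\mathrm{alg}(A_k^\ell,A_k^r)$, for all $k\in K$ and $n\ge0$: $C_k'\mathbb A_kC_k'=\{0\}=D_k'\mathbb A_kD_k'$, $E(\mathbb A_kC_k'\mathbb A_k(D_k'\mathbb A_kC_k')^n\mathbb A_k)=0$ and $E(\mathbb A_kD_k'\mathbb A_k(C_k'\mathbb A_kD_k')^n\mathbb A_k)=0$. **Statement.** Let $(A_k^\ell,A_k^r,A_k^b)_{k\in K}$ be free-free-Boolean independent over $B$ in $(\mathcal A,E_{\mathcal A},\varepsilon)$. Call $(\mathcal X,\theta)$ a representation of $\mathcal A$ if $\mathcal X=B\oplus\mathcal X^\circ$ is a $B$-$B$-bimodule with a specified $B$-projection and $\theta:\mathcal A\to\mathcal L(\mathcal X)$ is a unital homomorphism with $\theta(L_bR_c)=L_bR_c$ and $E_{\mathcal L(\mathcal X)}(\theta(T))=E_{\mathcal A}(T)$. Given one, let $\mathcal Y_k=\mathcal X\oplus\mathcal X$ with $\mathcal Y_k^\circ=\mathcal X^\circ\oplus\mathcal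 X$ for each $k\in K$, let $\mathcal Y$ be the reduced free product of $(\mathcal Y_k)_{k\in K}$, let $D_Z(\xi_1\oplus\xi_2)=\theta(Z)\xi_1\oplus\theta(Z)\xi_2$, $T_Z(\xi_1\oplus\xi_2)=\theta(Z)\xi_2\oplus0$, $S(\xi_1\oplus\xi_2)=0\oplus\xi_1$ on $\mathcal Y_k$, and put $$\tilde A_k^\ell=\lambda_k(D_{A_k^\ell}),\quad\tilde A_k^r=\rho_k(D_{A_k^r}),\quad C_k'=\{\lambda_k(T_Z):Z\in A_k^b\},\quad D_k'=\{\rho_k(S)\},$$ $$\alpha_{\ell,k}(Z)=\lambda_k(D_Z),\quad\alpha_{r,k}(Z)=\rho_k(D_Z),\quad\alpha_{b,k}(Z)=\lambda_k(T_Z)\rho_k(S).$$ 1. For every representation $(\mathcal X,\theta)$, these operators are well defined, $\{(\tilde A_k^\ell,\tilde A_k^r,C_k',D_k')\}_{k\in K}$ is a bi-free ffb $B$-system in $\mathcal L(\mathcal Y)$, and $\alpha_{\ell,k}:A_k^\ell\to\tilde A_k^\ell$, $\alpha_{r,k}:A_k^r\to\tilde A_k^r$, $\alpha_{b,k}:A_k^b\to\mathrm{alg}(C_k'D_k')$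 are linear maps that are $B$-linear on both sides (through the $L_b$ for $\alpha_{\ell,k}$ and $\alpha_{b,k}$, through the $R_b$ for $\alpha_{r,k}$). Moreover, for all $k\in K$, $n\ge0$, $\chi:\{1,\dots,n\}\to\{\ell,r,b\}$ and $Z_i\in A_k^{\chi(i)}$, $$E_{\mathcal L(\mathcal Y)}(\alpha_{\chi(1),k}(Z_1)\cdots\alpha_{\chi(n),k}(Z_n))=E_{\mathcal A}(Z_1\cdots Z_n).$$ Each of $\alpha_{\ell,k},\alpha_{r,k},\alpha_{b,k}$ is injective if $\theta$ is injective on its domain. 2. There is a representation $(\mathcal X,\theta)$ for which all the maps $\alpha_{\ell,k},\alpha_{r,k},\alpha_{b,k}$ are injective. -/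

import Mathlib

open scoped TensorProduct Pointwise
open MulOpposite

universe u v w t s

/-! ### Bimodules with a specified projection -/

/-- A `B`-`B`-bimodule (compatible with the complex structure). A bimodule with a specified
`B`-projection `𝒳 = B ⊕ 𝒳°` is given by its summand `𝒳°`. -/
structure BBimod (B : Type u) [Ring B] [Algebra ℂ B] where
  carrier : Type w
  [addCommGroup : AddCommGroup carrier]
  [moduleC : Module ℂ carrier]
  [moduleL : Module B carrier]
  [moduleR : Module Bᵐᵒᵖ carrier]
  [comm : SMulCommClass B Bᵐᵒᵖ carrier]
  [towerL : IsScalarTower ℂ B carrier]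
  [towerR : IsScalarTower ℂ Bᵐᵒᵖ carrier]

attribute [instance] BBimod.addCommGroup BBimod.moduleC BBimod.moduleL BBimod.moduleR
  BBimod.comm BBimod.towerL BBimod.towerR

namespace BBimod

variable {B : Type u} [Ring B] [Algebra ℂ B]

/-- The bimodule `𝒳 = B ⊕ 𝒳°`; the specified projection is `Prod.fst`. -/
abbrev Tot (X : BBimod.{u, w} B) : Type (max u w) := B × X.carrier

end BBimod

/-! ### `B`-`B`-non-commutative probability spaces -/

/-- The structure `(E, ε)` of a `B`-`B`-non-commutative probability space on the unital
algebra `A`. -/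
structure NCPS (B : Type u) [Ring B] [Algebra ℂ B] (A : Type v) [Ring A] [Algebra ℂ A] where
  E : A →ₗ[ℂ] B
  ε : B ⊗[ℂ] Bᵐᵒᵖ →ₐ[ℂ] A
  injective_left : Function.Injective fun b : B => ε (b ⊗ₜ[ℂ] (1 : Bᵐᵒᵖ))
  injective_right : Function.Injective fun b : Bᵐᵒᵖ => ε ((1 : B) ⊗ₜ[ℂ] b)
  E_bimod : ∀ (b₁ b₂ : B) (T : A), E (ε (b₁ ⊗ₜ[ℂ] op b₂) * T) = b₁ * E T * b₂
  E_right : ∀ (b : B) (T : A),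
    E (T * ε (b ⊗ₜ[ℂ] (1 : Bᵐᵒᵖ))) = E (T * ε ((1 : B) ⊗ₜ[ℂ] op b))

namespace NCPS

variable {B : Type u} [Ring B] [Algebra ℂ B] {A : Type v} [Ring A] [Algebra ℂ A]

/-- `L_b = ε (b ⊗ 1)`. -/
def L (S : NCPS B A) (b : B) : A := S.ε (b ⊗ₜ[ℂ] (1 : Bᵐᵒᵖ))

/-- `R_b = ε (1 ⊗ b)`. -/
def R (S : NCPS B A) (b : B) : A := S.ε ((1 : B) ⊗ₜ[ℂ] op b)

/-- The left algebra: the elements commuting with every `R_b`. -/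
def leftAlg (S : NCPS B A) : Subalgebra ℂ A := Subalgebra.centralizer ℂ (Set.range S.R)

/-- The right algebra: the elements commuting with every `L_b`. -/
def rightAlg (S : NCPS B A) : Subalgebra ℂ A := Subalgebra.centralizer ℂ (Set.range S.L)

/-- `(C, D)` is a pair of `B`-faces. -/
def IsPair (S : NCPS B A) (C D : Subalgebra ℂ A) : Prop :=
  ((∀ b, S.L b ∈ C) ∧ C ≤ S.leftAlg) ∧ ((∀ b, S.R b ∈ D) ∧ D ≤ S.rightAlg)

/-- `(Al, Ar, Ab)` is a triple of `B`-faces; `Ab` need not be unital. -/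
def IsTriple (S : NCPS B A) (Al Ar : Subalgebra ℂ A) (Ab : NonUnitalSubalgebra ℂ A) : Prop :=
  S.IsPair Al Ar ∧ (∀ b₁ b₂, ∀ d ∈ Ab, S.L b₁ * d * S.L b₂ ∈ Ab) ∧ ∀ d ∈ Ab, d ∈ S.leftAlg

end NCPS

namespace BBimod

variable {B : Type u} [Ring B] [Algebra ℂ B]

/-- The homomorphism `b₁ ⊗ b₂ ↦ L_{b₁} R_{b₂}`. -/
noncomputable def eps (X : BBimod.{u, w} B) : B ⊗[ℂ] Bᵐᵒᵖ →ₐ[ℂ] Module.End ℂ X.Tot :=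
  Algebra.TensorProduct.lift (Algebra.lsmul ℂ ℂ X.Tot) (Algebra.lsmul ℂ ℂ X.Tot) (by
    intro b c
    ext x <;> simp [smul_comm, mul_assoc])

@[simp] theorem eps_tmul_apply (X : BBimod.{u, w} B) (b : B) (c : Bᵐᵒᵖ) (x : X.Tot) :
    X.eps (b ⊗ₜ[ℂ] c) x = b • c • x := by
  unfold eps
  erw [Algebra.TensorProduct.lift_tmul]
  rfl

/-- The algebra `ℒ(𝒳)` of all complex linear maps on `𝒳 = B ⊕ 𝒳°`, with
`E a = p (a (1 ⊕ 0))` and `ε (b₁ ⊗ b₂) = L_{b₁} R_{b₂}`. -/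
noncomputable def space (X : BBimod.{u, w} B) : NCPS B (Module.End ℂ X.Tot) where
  E := LinearMap.fst ℂ B X.carrier ∘ₗ LinearMap.applyₗ ((1 : B), (0 : X.carrier))
  ε := X.eps
  injective_left := by
    intro b c h
    simpa using congrArg (fun T : Module.End ℂ X.Tot => (T (1, 0)).1) h
  injective_right := by
    intro b c h
    simpa using congrArg (fun T : Module.End ℂ X.Tot => (T (1, 0)).1) h
  E_bimod := by
    intro b₁ b₂ T
    simp [mul_assoc]
  E_right := by
    intro b T
    simp

/-- `𝒴 = 𝒳 ⊕ 𝒳` with `𝒴° = 𝒳° ⊕ 𝒳`. -/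
def double (X : BBimod.{u, w} B) : BBimod.{u, max u w} B where
  carrier := X.carrier × X.Tot

/-- The identification of `𝒴 = B ⊕ (𝒳° ⊕ 𝒳)` with `𝒳 ⊕ 𝒳`. -/
def split (X : BBimod.{u, w} B) : X.double.Tot ≃ₗ[ℂ] X.Tot × X.Tot :=
  (LinearEquiv.prodAssoc ℂ B X.carrier X.Tot).symm

/-- `ξ₁ ⊕ ξ₂ ↦ T ξ₁ ⊕ T ξ₂`. -/
def diag (X : BBimod.{u, w} B) (T : Module.End ℂ X.Tot) : Module.End ℂ X.double.Tot :=
  X.split.symm.toLinearMap ∘ₗ T.prodMap T ∘ₗ X.split.toLinearMap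

/-- `ξ₁ ⊕ ξ₂ ↦ T ξ₂ ⊕ 0`. -/
def raise (X : BBimod.{u, w} B) (T : Module.End ℂ X.Tot) : Module.End ℂ X.double.Tot :=
  X.split.symm.toLinearMap ∘ₗ
    (LinearMap.inl ℂ X.Tot X.Tot ∘ₗ T ∘ₗ LinearMap.snd ℂ X.Tot X.Tot) ∘ₗ X.split.toLinearMap

/-- `ξ₁ ⊕ ξ₂ ↦ 0 ⊕ ξ₁`. -/
def lower (X : BBimod.{u, w} B) : Module.End ℂ X.double.Tot :=
  X.split.symm.toLinearMap ∘ₗ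
    (LinearMap.inr ℂ X.Tot X.Tot ∘ₗ LinearMap.fst ℂ X.Tot X.Tot) ∘ₗ X.split.toLinearMap

end BBimod

/-! ### The reduced free product of bimodules -/

namespace RedFree

variable {B : Type u} [Ring B] [Algebra ℂ B] {K : Type t} (X : K → BBimod.{u, w} B)

/-- A letter is an element of some `𝒳°_k`. -/
abbrev Letter : Type (max t w) := Σ k : K, (X k).carrier

/-- A list of letters is good if it is nonempty and neighbouring indices differ. -/
def Good {X : K → BBimod.{u, w} B} (l : List (Letter X)) : Prop :=
  l ≠ [] ∧ (l.map Sigma.fst).IsChain (· ≠ ·)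

/-- The relations which turn formal combinations of lists of letters into the direct sum over all
`k₁ ≠ k₂ ≠ ⋯ ≠ k_n`, `n ≥ 1`, of `𝒳°_{k₁} ⊗_B ⋯ ⊗_B 𝒳°_{k_n}`: lists which are not good are
discarded, a list is additive and homogeneous in each letter, and `B` can be moved across each
tensor sign. -/
inductive Rel : (List (Letter X) →₀ ℂ) → Prop
  | bad (l : List (Letter X)) (h : ¬ Good l) : Rel (Finsupp.single l 1)
  | add (p q : List (Letter X)) (k : K) (m n : (X k).carrier) :
      Rel (Finsupp.single (p ++ ⟨k, m + n⟩ :: q) 1 -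
        (Finsupp.single (p ++ ⟨k, m⟩ :: q) 1 + Finsupp.single (p ++ ⟨k, n⟩ :: q) 1))
  | smul (p q : List (Letter X)) (k : K) (c : ℂ) (m : (X k).carrier) :
      Rel (Finsupp.single (p ++ ⟨k, c • m⟩ :: q) 1 - c • Finsupp.single (p ++ ⟨k, m⟩ :: q) 1)
  | bal (p q : List (Letter X)) (k j : K) (m : (X k).carrier) (b : B) (n : (X j).carrier) :
      Rel (Finsupp.single (p ++ ⟨k, op b • m⟩ :: ⟨j, n⟩ :: q) 1 -
        Finsupp.single (p ++ ⟨k, m⟩ :: ⟨j, b • n⟩ :: q) 1)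

/-- `𝒳° = ⨁ 𝒳°_{k₁} ⊗_B ⋯ ⊗_B 𝒳°_{k_n}` over all `n ≥ 1` and `k₁ ≠ k₂ ≠ ⋯ ≠ k_n`. -/
def Circ : Type (max t w) :=
  (List (Letter X) →₀ ℂ) ⧸ Submodule.span ℂ {x | Rel X x}

noncomputable instance : AddCommGroup (Circ X) :=
  inferInstanceAs (AddCommGroup ((List (Letter X) →₀ ℂ) ⧸ Submodule.span ℂ {x | Rel X x}))

noncomputable instance : Module ℂ (Circ X) :=
  inferInstanceAs (Module ℂ ((List (Letter X) →₀ ℂ) ⧸ Submodule.span ℂ {x | Rel X x}))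

variable {X}

/-- The elementary tensor of a list of letters. -/
noncomputable def mk (l : List (Letter X)) : Circ X :=
  Submodule.Quotient.mk (Finsupp.single l 1)

/-- A function on lists of letters that is multilinear and balanced. -/
structure Multi {N : Type*} [AddCommGroup N] [Module ℂ N] (f : List (Letter X) → N) : Prop where
  add : ∀ p q k m n, f (p ++ ⟨k, m + n⟩ :: q) = f (p ++ ⟨k, m⟩ :: q) + f (p ++ ⟨k, n⟩ :: q)
  smul : ∀ p q k (c : ℂ) m, f (p ++ ⟨k, c • m⟩ :: q) = c • f (p ++ ⟨k, m⟩ :: q)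
  bal : ∀ p q k j m (b : B) n,
    f (p ++ ⟨k, op b • m⟩ :: ⟨j, n⟩ :: q) = f (p ++ ⟨k, m⟩ :: ⟨j, b • n⟩ :: q)

/-- A function on lists of letters that respects all relations. -/
structure Compat {N : Type*} [AddCommGroup N] [Module ℂ N] (f : List (Letter X) → N) : Prop
    extends Multi f where
  bad : ∀ l, ¬ Good l → f l = 0

theorem mk_compat : Compat (mk : List (Letter X) → Circ X) where
  bad l h := (Submodule.Quotient.mk_eq_zero _).2 (Submodule.subset_span (Rel.bad l h))
  add p q k m n :=
    (Submodule.Quotient.eq _).2 (Submodule.subset_span (Rel.add p q k m n))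
  smul p q k c m :=
    (Submodule.Quotient.eq _).2 (Submodule.subset_span (Rel.smul p q k c m))
  bal p q k j m b n :=
    (Submodule.Quotient.eq _).2 (Submodule.subset_span (Rel.bal p q k j m b n))

/-- The linear map on `𝒳°` determined by its values on elementary tensors. -/
noncomputable def lift {N : Type*} [AddCommGroup N] [Module ℂ N] (f : List (Letter X) → N)
    (hf : Compat f) : Circ X →ₗ[ℂ] N :=
  Submodule.liftQ _ (Finsupp.linearCombination ℂ f) (by
    rw [Submodule.span_le]
    rintro x (⟨l, h⟩ | ⟨p, q, k, m, n⟩ | ⟨p, q, k, c, m⟩ | ⟨p, q, k, j, m, b, n⟩)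
    · simp [hf.bad l h]
    · simp [hf.add]
    · simp [hf.smul]
    · simp [hf.bal])

@[simp] theorem lift_mk {N : Type*} [AddCommGroup N] [Module ℂ N] (f : List (Letter X) → N)
    (hf : Compat f) (l : List (Letter X)) : lift f hf (mk l) = f l := by
  unfold lift mk
  erw [Submodule.liftQ_apply]
  simp

theorem hom_ext {N : Type*} [AddCommGroup N] [Module ℂ N] {f g : Circ X →ₗ[ℂ] N}
    (h : ∀ l, f (mk l) = g (mk l)) : f = g := by
  refine Submodule.linearMap_qext _ (Finsupp.lhom_ext' fun l => LinearMap.ext_ring ?_)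
  exact h l

theorem good_congr {l l' : List (Letter X)} (h : l.map Sigma.fst = l'.map Sigma.fst) :
    Good l ↔ Good l' := by
  have h₀ : l = [] ↔ l' = [] := by
    rw [← List.map_eq_nil_iff (f := Sigma.fst), h, List.map_eq_nil_iff]
  simp only [Good, h, ne_eq, h₀]

/-- `b (x₁ ⊗ ⋯ ⊗ x_n) = (b x₁) ⊗ ⋯ ⊗ x_n`. -/
noncomputable def leftFun (b : B) : List (Letter X) → Circ X
  | [] => 0
  | ⟨k, m⟩ :: q => mk (⟨k, b • m⟩ :: q)

/-- `(x₁ ⊗ ⋯ ⊗ x_n) b = x₁ ⊗ ⋯ ⊗ (x_n b)`. -/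
noncomputable def rightFun (b : Bᵐᵒᵖ) (l : List (Letter X)) : Circ X :=
  match l.reverse with
  | [] => 0
  | ⟨k, m⟩ :: q => mk (q.reverse ++ [⟨k, b • m⟩])

@[simp] theorem leftFun_cons (b : B) (k : K) (m : (X k).carrier) (q : List (Letter X)) :
    leftFun b (⟨k, m⟩ :: q) = mk (⟨k, b • m⟩ :: q) := rfl

@[simp] theorem rightFun_concat (b : Bᵐᵒᵖ) (k : K) (m : (X k).carrier) (q : List (Letter X)) :
    rightFun b (q ++ [⟨k, m⟩]) = mk (q ++ [⟨k, b • m⟩]) := by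
  simp [rightFun]

theorem leftFun_compat (b : B) : Compat (leftFun b : List (Letter X) → Circ X) where
  bad l h := by
    rcases l with _ | ⟨⟨k, m⟩, q⟩
    · rfl
    · exact mk_compat.bad _ (mt (good_congr (by simp)).1 h)
  add p q k m n := by
    rcases p with _ | ⟨⟨j, x⟩, p⟩
    · simpa using mk_compat.add [] q k (b • m) (b • n)
    · exact mk_compat.add (⟨j, b • x⟩ :: p) q k m n
  smul p q k c m := by
    rcases p with _ | ⟨⟨j, x⟩, p⟩
    · simpa [smul_comm b c] using mk_compat.smul [] q k c (b • m)
    · exact mk_compat.smul (⟨j, b • x⟩ :: p) q k c m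
  bal p q k j m c n := by
    rcases p with _ | ⟨⟨i, x⟩, p⟩
    · simpa [smul_comm b (op c)] using mk_compat.bal [] q k j (b • m) c n
    · exact mk_compat.bal (⟨i, b • x⟩ :: p) q k j m c n

theorem rightFun_compat (b : Bᵐᵒᵖ) : Compat (rightFun b : List (Letter X) → Circ X) where
  bad l h := by
    rcases List.eq_nil_or_concat l with rfl | ⟨q, ⟨k, m⟩, rfl⟩
    · rfl
    · rw [List.concat_eq_append] at h ⊢
      rw [rightFun_concat]
      exact mk_compat.bad _ (mt (good_congr (by simp)).1 h)
  add p q k m n := by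
    rcases List.eq_nil_or_concat q with rfl | ⟨q, ⟨j, x⟩, rfl⟩
    · simpa using mk_compat.add p [] k (b • m) (b • n)
    · have h := mk_compat.add p (q ++ [⟨j, b • x⟩]) k m n
      have h₀ := fun y => rightFun_concat b j x (p ++ (⟨k, y⟩ : Letter X) :: q)
      simp only [List.append_assoc, List.cons_append] at h₀
      rw [List.concat_eq_append, h₀, h₀, h₀, h]
  smul p q k c m := by
    rcases List.eq_nil_or_concat q with rfl | ⟨q, ⟨j, x⟩, rfl⟩
    · simpa [smul_comm b c] using mk_compat.smul p [] k c (b • m)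
    · have h := mk_compat.smul p (q ++ [⟨j, b • x⟩]) k c m
      have h₀ := fun y => rightFun_concat b j x (p ++ (⟨k, y⟩ : Letter X) :: q)
      simp only [List.append_assoc, List.cons_append] at h₀
      rw [List.concat_eq_append, h₀, h₀, h]
  bal p q k j m c n := by
    rcases List.eq_nil_or_concat q with rfl | ⟨q, ⟨i, x⟩, rfl⟩
    · have h := mk_compat.bal p [] k j m c (b • n)
      have h₁ := rightFun_concat b j n (p ++ [(⟨k, op c • m⟩ : Letter X)])
      have h₂ := rightFun_concat b j (c • n) (p ++ [(⟨k, m⟩ : Letter X)])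
      simp only [List.append_assoc, List.singleton_append] at h₁ h₂
      rw [h₁, h₂, h, smul_comm c b n]
    · have h := mk_compat.bal p (q ++ [⟨i, b • x⟩]) k j m c n
      have h₁ := rightFun_concat b i x (p ++ (⟨k, op c • m⟩ : Letter X) :: ⟨j, n⟩ :: q)
      have h₂ := rightFun_concat b i x (p ++ (⟨k, m⟩ : Letter X) :: ⟨j, c • n⟩ :: q)
      simp only [List.append_assoc, List.cons_append] at h₁ h₂
      rw [List.concat_eq_append, h₁, h₂, h]

/-- The left action of `B` on `𝒳°`. -/
noncomputable def leftAct : B →+* Module.End ℂ (Circ X) where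
  toFun b := lift (leftFun b) (leftFun_compat b)
  map_one' := hom_ext fun l => by
    rcases l with _ | ⟨⟨k, m⟩, q⟩
    · simpa [leftFun] using (mk_compat.bad ([] : List (Letter X)) (by simp [Good])).symm
    · simp
  map_mul' b c := hom_ext fun l => by
    rcases l with _ | ⟨⟨k, m⟩, q⟩
    · simp [leftFun]
    · simp [mul_smul]
  map_zero' := hom_ext fun l => by
    rcases l with _ | ⟨⟨k, m⟩, q⟩
    · simp [leftFun]
    · simpa using mk_compat.smul [] q k 0 m
  map_add' b c := hom_ext fun l => by
    rcases l with _ | ⟨⟨k, m⟩, q⟩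
    · simp [leftFun]
    · simpa [add_smul] using mk_compat.add [] q k (b • m) (c • m)

/-- The right action of `B` on `𝒳°`. -/
noncomputable def rightAct : Bᵐᵒᵖ →+* Module.End ℂ (Circ X) where
  toFun b := lift (rightFun b) (rightFun_compat b)
  map_one' := hom_ext fun l => by
    rcases List.eq_nil_or_concat l with rfl | ⟨q, ⟨k, m⟩, rfl⟩
    · simpa [rightFun] using (mk_compat.bad ([] : List (Letter X)) (by simp [Good])).symm
    · simp
  map_mul' b c := hom_ext fun l => by
    rcases List.eq_nil_or_concat l with rfl | ⟨q, ⟨k, m⟩, rfl⟩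
    · simp [rightFun]
    · simp [mul_smul]
  map_zero' := hom_ext fun l => by
    rcases List.eq_nil_or_concat l with rfl | ⟨q, ⟨k, m⟩, rfl⟩
    · simp [rightFun]
    · simpa using mk_compat.smul q [] k 0 m
  map_add' b c := hom_ext fun l => by
    rcases List.eq_nil_or_concat l with rfl | ⟨q, ⟨k, m⟩, rfl⟩
    · simp [rightFun]
    · simpa [add_smul] using mk_compat.add q [] k (b • m) (c • m)

noncomputable instance : Module B (Circ X) := Module.compHom (Circ X) (leftAct (X := X))
noncomputable instance : Module Bᵐᵒᵖ (Circ X) := Module.compHom (Circ X) (rightAct (X := X))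

theorem smul_def (b : B) (x : Circ X) : b • x = leftAct b x := rfl
theorem op_smul_def (b : Bᵐᵒᵖ) (x : Circ X) : b • x = rightAct b x := rfl

@[simp] theorem smul_mk (b : B) (k : K) (m : (X k).carrier) (q : List (Letter X)) :
    b • mk (⟨k, m⟩ :: q) = mk (⟨k, b • m⟩ :: q) := by
  simp [smul_def, leftAct]

@[simp] theorem op_smul_mk (b : Bᵐᵒᵖ) (k : K) (m : (X k).carrier) (q : List (Letter X)) :
    b • mk (q ++ [⟨k, m⟩]) = mk (q ++ [⟨k, b • m⟩]) := by
  simp [op_smul_def, rightAct]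

theorem mk_nil : mk ([] : List (Letter X)) = 0 := mk_compat.bad _ (by simp [Good])

instance : SMulCommClass B Bᵐᵒᵖ (Circ X) where
  smul_comm b c x := by
    have h : (leftAct b * rightAct c : Module.End ℂ (Circ X)) = rightAct c * leftAct b :=
      hom_ext fun l => by
        rcases l with _ | ⟨⟨k, m⟩, q⟩
        · simp [mk_nil]
        · simp only [Module.End.mul_apply, ← smul_def, ← op_smul_def]
          rcases List.eq_nil_or_concat q with rfl | ⟨q, ⟨j, n⟩, rfl⟩
          · have h₁ := fun y => op_smul_mk c k y ([] : List (Letter X))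
            simp only [List.nil_append] at h₁
            simp [h₁, smul_comm b c m]
          · have h₁ := fun y => op_smul_mk c j n ((⟨k, y⟩ : Letter X) :: q)
            simp only [List.cons_append] at h₁
            simp [h₁]
    exact LinearMap.congr_fun h x

instance : IsScalarTower ℂ B (Circ X) where
  smul_assoc c b x := by
    have h : (leftAct (c • b) : Module.End ℂ (Circ X)) = c • leftAct b :=
      hom_ext fun l => by
        rcases l with _ | ⟨⟨k, m⟩, q⟩
        · simp [mk_nil]
        · simpa [← smul_def] using mk_compat.smul [] q k c (b • m)
    exact LinearMap.congr_fun h x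

instance : IsScalarTower ℂ Bᵐᵒᵖ (Circ X) where
  smul_assoc c b x := by
    have h : (rightAct (c • b) : Module.End ℂ (Circ X)) = c • rightAct b :=
      hom_ext fun l => by
        rcases List.eq_nil_or_concat l with rfl | ⟨q, ⟨k, m⟩, rfl⟩
        · simp [mk_nil]
        · simpa [← op_smul_def] using mk_compat.smul q [] k c (b • m)
    exact LinearMap.congr_fun h x

variable (X) in
/-- The reduced free product `𝒳 = B ⊕ 𝒳°` of the bimodules `𝒳_k = B ⊕ 𝒳°_k`. -/
noncomputable abbrev prod : BBimod.{u, max t w} B where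
  carrier := Circ X

/-- The elementary tensor of a list of letters in `𝒳`; the empty list gives `1 ∈ B`. -/
noncomputable def vec (l : List (Letter X)) : B × Circ X := (if l = [] then 1 else 0, mk l)

theorem vec_nil : vec ([] : List (Letter X)) = (1, 0) := by simp [vec, mk_nil]

@[simp] theorem vec_mid (p q : List (Letter X)) (a : Letter X) :
    vec (p ++ a :: q) = (0, mk (p ++ a :: q)) := by simp [vec]

/-- `x ⊗ l` in `𝒳_k ⊗_B 𝒳`, read in `𝒳`, for a list `l` that does not start with `k`. -/
noncomputable def lcons (k : K) (x : B × (X k).carrier) (l : List (Letter X)) : B × Circ X :=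
  x.1 • vec l + (0, mk (⟨k, x.2⟩ :: l))

/-- `l ⊗ x` in `𝒳 ⊗_B 𝒳_k`, read in `𝒳`, for a list `l` that does not end with `k`. -/
noncomputable def rcons (k : K) (x : B × (X k).carrier) (l : List (Letter X)) : B × Circ X :=
  op x.1 • vec l + (0, mk (l ++ [⟨k, x.2⟩]))

open Classical in
/-- The component of a letter in `𝒳°_k`. -/
noncomputable def comp (k : K) (a : Letter X) : (X k).carrier :=
  if h : a.1 = k then h ▸ a.2 else 0

@[simp] theorem comp_self (k : K) (m : (X k).carrier) : comp k (⟨k, m⟩ : Letter X) = m := by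
  simp [comp]

/-- The inclusion of `𝒳_k = B ⊕ 𝒳°_k` in `𝒳`. -/
noncomputable def incl (k : K) : (X k).Tot →ₗ[ℂ] (prod X).Tot where
  toFun x := (x.1, mk [⟨k, x.2⟩])
  map_add' x y := by
    exact Prod.ext rfl (mk_compat.add [] [] k x.2 y.2)
  map_smul' c x := by
    exact Prod.ext rfl (mk_compat.smul [] [] k c x.2)

open Classical in
/-- The value of the projection onto `𝒳°_k` on an elementary tensor. -/
noncomputable def projFun (k : K) : List (Letter X) → (X k).carrier
  | [a] => comp k a
  | _ => 0

theorem comp_compat (k : K) (j : K) (c : ℂ) (m n : (X j).carrier) :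
    comp k (⟨j, m + n⟩ : Letter X) = comp k ⟨j, m⟩ + comp k ⟨j, n⟩ ∧
      comp k (⟨j, c • m⟩ : Letter X) = c • comp k ⟨j, m⟩ := by
  by_cases h : j = k
  · subst h; simp
  · simp [comp, h]

theorem projFun_compat (k : K) : Compat (projFun k : List (Letter X) → (X k).carrier) where
  bad l h := by
    rcases l with _ | ⟨a, _ | ⟨b, l⟩⟩
    · rfl
    · exact absurd (by simp [Good]) h
    · rfl
  add p q j m n := by
    rcases p with _ | ⟨a, _ | ⟨b, p⟩⟩
    · rcases q with _ | ⟨a, q⟩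
      · exact (comp_compat k j 0 m n).1
      · simp [projFun]
    · simp [projFun]
    · simp [projFun]
  smul p q j c m := by
    rcases p with _ | ⟨a, _ | ⟨b, p⟩⟩
    · rcases q with _ | ⟨a, q⟩
      · exact (comp_compat k j c m 0).2
      · simp [projFun]
    · simp [projFun]
    · simp [projFun]
  bal p q i j m b n := by
    rcases p with _ | ⟨a, _ | ⟨b, p⟩⟩ <;> simp [projFun]

/-- The projection of `𝒳` onto its summand `𝒳_k = B ⊕ 𝒳°_k`. -/
noncomputable def proj (k : K) : (prod X).Tot →ₗ[ℂ] (X k).Tot :=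
  LinearMap.prodMap LinearMap.id (lift (projFun k) (projFun_compat k))

/-- The `k`-th Boolean projection. -/
noncomputable def boolProj (k : K) : Module.End ℂ (prod X).Tot := incl k ∘ₗ proj k

/-- `P_k λ_k(T) P_k`: the operator `T` on the summand `𝒳_k ≅ 𝒳_k ⊗_B B` of `𝒳` and `0` on the
other tensors. It makes sense for every linear `T`. -/
noncomputable def boolRep (k : K) (T : Module.End ℂ (X k).Tot) : Module.End ℂ (prod X).Tot :=
  incl k ∘ₗ T ∘ₗ proj k

theorem lcons_add (k : K) (x y : B × (X k).carrier) (l : List (Letter X)) :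
    lcons k (x + y) l = lcons k x l + lcons k y l := by
  have h := mk_compat.add [] l k x.2 y.2
  simp only [List.nil_append] at h
  ext
  · simp [lcons, add_mul]
  · simp [lcons, h, add_smul]; abel

theorem lcons_smul (k : K) (c : ℂ) (x : B × (X k).carrier) (l : List (Letter X)) :
    lcons k (c • x) l = c • lcons k x l := by
  have h := mk_compat.smul [] l k c x.2
  simp only [List.nil_append] at h
  ext <;> simp [lcons, h]

theorem rcons_add (k : K) (x y : B × (X k).carrier) (l : List (Letter X)) :
    rcons k (x + y) l = rcons k x l + rcons k y l := by
  have h := mk_compat.add l [] k x.2 y.2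
  ext
  · simp [rcons, mul_add]
  · simp [rcons, h, add_smul]; abel

theorem rcons_smul (k : K) (c : ℂ) (x : B × (X k).carrier) (l : List (Letter X)) :
    rcons k (c • x) l = c • rcons k x l := by
  have h := mk_compat.smul l [] k c x.2
  ext <;> simp [rcons, h]

/-- `(x b) ⊗ n ⊗ ⋯ = x ⊗ (b n) ⊗ ⋯`. -/
theorem lcons_bal (k j : K) (b : B) (x : B × (X k).carrier) (n : (X j).carrier)
    (q : List (Letter X)) :
    lcons k (op b • x) (⟨j, n⟩ :: q) = lcons k x (⟨j, b • n⟩ :: q) := by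
  have h := mk_compat.bal [] q k j x.2 b n
  simp only [List.nil_append] at h
  ext <;> simp [lcons, vec, h, mul_smul]

/-- `⋯ ⊗ (m b) ⊗ x = ⋯ ⊗ m ⊗ (b x)`. -/
theorem rcons_bal (k j : K) (b : B) (x : B × (X k).carrier) (m : (X j).carrier)
    (p : List (Letter X)) :
    rcons k x (p ++ [⟨j, op b • m⟩]) = rcons k (b • x) (p ++ [⟨j, m⟩]) := by
  have h := mk_compat.bal p [] j k m b x.2
  ext <;> simp [rcons, vec, h, mul_smul]

theorem lcons_multi (k : K) (x : B × (X k).carrier) : Multi (lcons k x) where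
  add p q j m n := by
    have h₁ := mk_compat.add p q j m n
    have h₂ := mk_compat.add (⟨k, x.2⟩ :: p) q j m n
    simp only [List.cons_append] at h₂
    ext
    · simp [lcons]
    · simp [lcons, h₁, h₂]; abel
  smul p q j c m := by
    have h₁ := mk_compat.smul p q j c m
    have h₂ := mk_compat.smul (⟨k, x.2⟩ :: p) q j c m
    simp only [List.cons_append] at h₂
    ext <;> simp [lcons, h₁, h₂, smul_comm x.1 c]
  bal p q i j m b n := by
    have h₁ := mk_compat.bal p q i j m b n
    have h₂ := mk_compat.bal (⟨k, x.2⟩ :: p) q i j m b n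
    simp only [List.cons_append] at h₂
    ext <;> simp [lcons, h₁, h₂]

theorem rcons_multi (k : K) (x : B × (X k).carrier) : Multi (rcons k x) where
  add p q j m n := by
    have h₁ := mk_compat.add p (q ++ [⟨k, x.2⟩]) j m n
    have h₂ := mk_compat.add p q j m n
    ext
    · simp [rcons]
    · simp [rcons, h₁, h₂]; abel
  smul p q j c m := by
    have h₁ := mk_compat.smul p (q ++ [⟨k, x.2⟩]) j c m
    have h₂ := mk_compat.smul p q j c m
    ext <;> simp [rcons, h₁, h₂, smul_comm (op x.1) c]
  bal p q i j m b n := by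
    have h₁ := mk_compat.bal p (q ++ [⟨k, x.2⟩]) i j m b n
    have h₂ := mk_compat.bal p q i j m b n
    ext <;> simp [rcons, h₁, h₂]

open Classical in
/-- The value of `T ⊗ Id` on an elementary tensor, under `𝒳 ≅ 𝒳_k ⊗_B 𝒳_ℓ(k)`: a first letter
`m ∈ 𝒳°_k` becomes `T m`, and if the first letter is not in `𝒳°_k` then `T 1` is put in front. -/
noncomputable def lamFun (k : K) (T : Module.End ℂ (X k).Tot) : List (Letter X) → B × Circ X
  | [] => 0
  | a :: q => if a.1 = k then lcons k (T (0, comp k a)) q else lcons k (T (1, 0)) (a :: q)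

open Classical in
/-- The value of `Id ⊗ T` on an elementary tensor, under `𝒳 ≅ 𝒳_r(k) ⊗_B 𝒳_k`: a last letter
`m ∈ 𝒳°_k` becomes `T m`, and if the last letter is not in `𝒳°_k` then `T 1` is put behind. -/
noncomputable def rhoFun (k : K) (T : Module.End ℂ (X k).Tot) (l : List (Letter X)) :
    B × Circ X :=
  match l.reverse with
  | [] => 0
  | a :: q => if a.1 = k then rcons k (T (0, comp k a)) q.reverse else rcons k (T (1, 0)) l

open Classical in
theorem rhoFun_concat (k : K) (T : Module.End ℂ (X k).Tot) (q : List (Letter X)) (a : Letter X) :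
    rhoFun k T (q ++ [a]) =
      if a.1 = k then rcons k (T (0, comp k a)) q else rcons k (T (1, 0)) (q ++ [a]) := by
  simp [rhoFun]

open Classical in
/-- Restriction of a function to good lists. -/
noncomputable def onGood {N : Type*} [AddCommGroup N] (f : List (Letter X) → N)
    (l : List (Letter X)) : N := if Good l then f l else 0

theorem onGood_compat {N : Type*} [AddCommGroup N] [Module ℂ N] {f : List (Letter X) → N}
    (hf : Multi f) : Compat (onGood f) where
  bad l h := if_neg h
  add p q k m n := by
    have e₁ : Good (p ++ (⟨k, m + n⟩ : Letter X) :: q) ↔ Good (p ++ (⟨k, m⟩ : Letter X) :: q) :=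
      good_congr (by simp)
    have e₂ : Good (p ++ (⟨k, n⟩ : Letter X) :: q) ↔ Good (p ++ (⟨k, m⟩ : Letter X) :: q) :=
      good_congr (by simp)
    by_cases h : Good (p ++ (⟨k, m⟩ : Letter X) :: q)
    · simpa only [onGood, if_pos h, if_pos (e₁.2 h), if_pos (e₂.2 h)] using hf.add p q k m n
    · simp only [onGood, if_neg h, if_neg (mt e₁.1 h), if_neg (mt e₂.1 h), add_zero]
  smul p q k c m := by
    have e₁ : Good (p ++ (⟨k, c • m⟩ : Letter X) :: q) ↔ Good (p ++ (⟨k, m⟩ : Letter X) :: q) :=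
      good_congr (by simp)
    by_cases h : Good (p ++ (⟨k, m⟩ : Letter X) :: q)
    · simpa only [onGood, if_pos h, if_pos (e₁.2 h)] using hf.smul p q k c m
    · simp only [onGood, if_neg h, if_neg (mt e₁.1 h), smul_zero]
  bal p q k j m b n := by
    have e₁ : Good (p ++ (⟨k, op b • m⟩ : Letter X) :: ⟨j, n⟩ :: q) ↔
        Good (p ++ (⟨k, m⟩ : Letter X) :: ⟨j, b • n⟩ :: q) := good_congr (by simp)
    by_cases h : Good (p ++ (⟨k, m⟩ : Letter X) :: ⟨j, b • n⟩ :: q)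
    · simpa only [onGood, if_pos h, if_pos (e₁.2 h)] using hf.bal p q k j m b n
    · simp only [onGood, if_neg h, if_neg (mt e₁.1 h)]

theorem lamFun_multi (k : K) (T : Module.End ℂ (X k).Tot)
    (hT : ∀ (b : B) x, T (op b • x) = op b • T x) :
    Multi (lamFun k T : List (Letter X) → B × Circ X) where
  add p q j m n := by
    rcases p with _ | ⟨a, p⟩
    · by_cases h : j = k
      · subst h
        simp [lamFun, ← lcons_add, ← map_add]
      · simpa [lamFun, h] using (lcons_multi k (T (1, 0))).add [] q j m n
    · by_cases h : a.1 = k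
      · simpa [lamFun, h] using (lcons_multi k (T (0, comp k a))).add p q j m n
      · simpa [lamFun, h] using (lcons_multi k (T (1, 0))).add (a :: p) q j m n
  smul p q j c m := by
    rcases p with _ | ⟨a, p⟩
    · by_cases h : j = k
      · subst h
        simp [lamFun, ← lcons_smul, ← map_smul]
      · simpa [lamFun, h] using (lcons_multi k (T (1, 0))).smul [] q j c m
    · by_cases h : a.1 = k
      · simpa [lamFun, h] using (lcons_multi k (T (0, comp k a))).smul p q j c m
      · simpa [lamFun, h] using (lcons_multi k (T (1, 0))).smul (a :: p) q j c m
  bal p q i j m b n := by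
    rcases p with _ | ⟨a, p⟩
    · by_cases h : i = k
      · subst h
        have h₃ := hT b (0, m)
        simp only [Prod.smul_mk, smul_zero] at h₃
        simp [lamFun, h₃, lcons_bal]
      · simpa [lamFun, h] using (lcons_multi k (T (1, 0))).bal [] q i j m b n
    · by_cases h : a.1 = k
      · simpa [lamFun, h] using (lcons_multi k (T (0, comp k a))).bal p q i j m b n
      · simpa [lamFun, h] using (lcons_multi k (T (1, 0))).bal (a :: p) q i j m b n

theorem rhoFun_multi (k : K) (T : Module.End ℂ (X k).Tot)
    (hT : ∀ (b : B) x, T (b • x) = b • T x) :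
    Multi (rhoFun k T : List (Letter X) → B × Circ X) where
  add p q j m n := by
    rcases List.eq_nil_or_concat q with rfl | ⟨q, a, rfl⟩
    · by_cases h : j = k
      · subst h
        simp [rhoFun_concat, ← rcons_add, ← map_add]
      · simpa [rhoFun_concat, h] using (rcons_multi k (T (1, 0))).add p [] j m n
    · have e (y) : p ++ (⟨j, y⟩ : Letter X) :: q.concat a = (p ++ ⟨j, y⟩ :: q) ++ [a] := by simp
      have h₀ := (rcons_multi k (T (1, 0))).add p (q.concat a) j m n
      simp only [e, rhoFun_concat] at h₀ ⊢
      by_cases h : a.1 = k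
      · simpa only [if_pos h] using (rcons_multi k (T (0, comp k a))).add p q j m n
      · simpa only [if_neg h] using h₀
  smul p q j c m := by
    rcases List.eq_nil_or_concat q with rfl | ⟨q, a, rfl⟩
    · by_cases h : j = k
      · subst h
        simp [rhoFun_concat, ← rcons_smul, ← map_smul]
      · simpa [rhoFun_concat, h] using (rcons_multi k (T (1, 0))).smul p [] j c m
    · have e (y) : p ++ (⟨j, y⟩ : Letter X) :: q.concat a = (p ++ ⟨j, y⟩ :: q) ++ [a] := by simp
      have h₀ := (rcons_multi k (T (1, 0))).smul p (q.concat a) j c m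
      simp only [e, rhoFun_concat] at h₀ ⊢
      by_cases h : a.1 = k
      · simpa only [if_pos h] using (rcons_multi k (T (0, comp k a))).smul p q j c m
      · simpa only [if_neg h] using h₀
  bal p q i j m b n := by
    rcases List.eq_nil_or_concat q with rfl | ⟨q, a, rfl⟩
    · have e (y) (z) : p ++ (⟨i, y⟩ : Letter X) :: [⟨j, z⟩] = (p ++ [⟨i, y⟩]) ++ [⟨j, z⟩] := by
        simp
      have h₀ := (rcons_multi k (T (1, 0))).bal p [] i j m b n
      simp only [e, rhoFun_concat] at h₀ ⊢
      by_cases h : j = k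
      · subst h
        have h₃ := hT b (0, n)
        simp only [Prod.smul_mk, smul_zero] at h₃
        simp [h₃, rcons_bal]
      · simpa only [if_neg h] using h₀
    · have e (y) (z) : p ++ (⟨i, y⟩ : Letter X) :: ⟨j, z⟩ :: q.concat a =
          (p ++ ⟨i, y⟩ :: ⟨j, z⟩ :: q) ++ [a] := by simp
      have h₀ := (rcons_multi k (T (1, 0))).bal p (q.concat a) i j m b n
      simp only [e, rhoFun_concat] at h₀ ⊢
      by_cases h : a.1 = k
      · simpa only [if_pos h] using (rcons_multi k (T (0, comp k a))).bal p q i j m b n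
      · simpa only [if_neg h] using h₀

theorem left_comm {Y : BBimod.{u, w} B} (T : Y.space.leftAlg) (b : B) (x : Y.Tot) :
    T.1 (op b • x) = op b • T.1 x := by
  have h := LinearMap.congr_fun ((Subalgebra.mem_centralizer_iff ℂ).1 T.2 _ ⟨b, rfl⟩) x
  simpa [NCPS.R, BBimod.space] using h.symm

theorem right_comm {Y : BBimod.{u, w} B} (T : Y.space.rightAlg) (b : B) (x : Y.Tot) :
    T.1 (b • x) = b • T.1 x := by
  have h := LinearMap.congr_fun ((Subalgebra.mem_centralizer_iff ℂ).1 T.2 _ ⟨b, rfl⟩) x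
  simpa [NCPS.L, BBimod.space] using h.symm

/-- The left regular representation `λ_k(T) = V_k⁻¹ (T ⊗ Id) V_k`, for `T ∈ ℒ_ℓ(𝒳_k)`. -/
noncomputable def lam (k : K) (T : (X k).space.leftAlg) : Module.End ℂ (prod X).Tot :=
  LinearMap.coprod (incl k ∘ₗ T.1 ∘ₗ LinearMap.inl ℂ B (X k).carrier)
    (lift (onGood (lamFun k T.1)) (onGood_compat (lamFun_multi k T.1 (left_comm T))))

/-- The right regular representation `ρ_k(T) = W_k⁻¹ (Id ⊗ T) W_k`, for `T ∈ ℒ_r(𝒳_k)`. -/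
noncomputable def rho (k : K) (T : (X k).space.rightAlg) : Module.End ℂ (prod X).Tot :=
  LinearMap.coprod (incl k ∘ₗ T.1 ∘ₗ LinearMap.inl ℂ B (X k).carrier)
    (lift (onGood (rhoFun k T.1)) (onGood_compat (rhoFun_multi k T.1 (right_comm T))))

@[simp] theorem lam_incl (k : K) (T : (X k).space.leftAlg) (x : (X k).Tot) :
    lam k T (incl k x) = incl k (T.1 x) := by
  have h : Good [(⟨k, x.2⟩ : Letter X)] := by simp [Good]
  have h₁ : lcons k (T.1 (0, x.2)) [] = (incl k (T.1 (0, x.2)) : (prod X).Tot) := by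
    ext <;> simp [lcons, vec_nil, incl]
  have h₂ : x = (x.1, 0) + (0, x.2) := by simp
  simp only [lam, LinearMap.coprod_apply]
  change incl k (T.1 (x.1, 0)) + lift _ _ (mk [⟨k, x.2⟩]) = _
  rw [lift_mk, onGood, if_pos h]
  simp only [lamFun, if_true, comp_self]
  rw [h₁, ← map_add, ← map_add, ← h₂]

@[simp] theorem proj_incl (k : K) (x : (X k).Tot) : proj k (incl k x : (prod X).Tot) = x := by
  change (x.1, lift _ (projFun_compat k) (mk [⟨k, x.2⟩])) = x
  rw [lift_mk]
  simp [projFun]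

/-- `boolRep k T` is `P_k λ_k(T) P_k` whenever `λ_k(T)` makes sense. -/
theorem boolRep_eq (k : K) (T : (X k).space.leftAlg) :
    boolRep k T.1 = boolProj k * lam k T * boolProj k := by
  refine LinearMap.ext fun x => ?_
  simp [boolRep, boolProj]

end RedFree

/-! ### Independence -/

namespace NCPS

variable {B : Type u} [Ring B] [Algebra ℂ B] {A : Type v} [Ring A] [Algebra ℂ A] {K : Type t}

/-- The family `(C k, D k)` of pairs of `B`-faces is bi-free over `B`. -/
def IsBiFree (S : NCPS B A) (C D : K → Subalgebra ℂ A) : Prop :=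
  (∀ k, S.IsPair (C k) (D k)) ∧
  ∃ (X : K → BBimod.{u, w} B) (l : ∀ k, C k →ₐ[ℂ] (X k).space.leftAlg)
    (r : ∀ k, D k →ₐ[ℂ] (X k).space.rightAlg),
    ∀ z : List (Σ k, C k ⊕ D k),
      S.E (z.map fun a => Sum.elim (fun c : C a.1 => (c : A)) (fun d : D a.1 => (d : A)) a.2).prod =
        (RedFree.prod X).space.E (z.map fun a =>
          Sum.elim (fun c => RedFree.lam a.1 (l a.1 c)) (fun d => RedFree.rho a.1 (r a.1 d))
            a.2).prod

/-- The family `(Al k, Ar k, Ab k)` of triples of `B`-faces is free-free-Boolean independent with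
amalgamation over `B`. -/
def IsFFB (S : NCPS B A) (Al Ar : K → Subalgebra ℂ A) (Ab : K → NonUnitalSubalgebra ℂ A) : Prop :=
  (∀ k, S.IsTriple (Al k) (Ar k) (Ab k)) ∧
  ∃ (X : K → BBimod.{u, w} B) (l : ∀ k, Al k →ₐ[ℂ] (X k).space.leftAlg)
    (r : ∀ k, Ar k →ₐ[ℂ] (X k).space.rightAlg) (m : ∀ k, Ab k →ₙₐ[ℂ] Module.End ℂ (X k).Tot),
    ∀ z : List (Σ k, Al k ⊕ Ar k ⊕ Ab k),
      S.E (z.map fun a => Sum.elim (fun c : Al a.1 => (c : A))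
          (Sum.elim (fun c : Ar a.1 => (c : A)) (fun c : Ab a.1 => (c : A))) a.2).prod =
        (RedFree.prod X).space.E (z.map fun a =>
          Sum.elim (fun c => RedFree.lam a.1 (l a.1 c))
            (Sum.elim (fun c => RedFree.rho a.1 (r a.1 c))
              (fun c => RedFree.boolRep a.1 (m a.1 c))) a.2).prod

/-- The underlying set of the algebra `𝔸 = alg (C, D)`. -/
def algSet (C D : Subalgebra ℂ A) : Set A := ((C ⊔ D : Subalgebra ℂ A) : Set A)

/-- `(Al k, Ar k, C' k, D' k)` is a bi-free ffb `B`-system; products of sets are pointwise. -/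
def IsFFBSystem (S : NCPS B A) (Al Ar : K → Subalgebra ℂ A) (C' D' : K → Set A) : Prop :=
  (∀ k, S.IsPair (Al k) (Ar k)) ∧
  (∃ C D : K → NonUnitalSubalgebra ℂ A,
    IsBiFree.{u, v, w, t} S (fun k => Algebra.adjoin ℂ ((Al k : Set A) ∪ C k))
      (fun k => Algebra.adjoin ℂ ((Ar k : Set A) ∪ D k)) ∧
    ∀ k, C' k ⊆ C k ∧ D' k ⊆ D k ∧ D' k ⊆ S.leftAlg) ∧
  (∀ k b, ∀ c ∈ C' k, S.L b * c ∈ C' k ∧ c * S.L b ∈ C' k) ∧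
  ∀ k, let 𝔸 := algSet (Al k) (Ar k)
    C' k * 𝔸 * C' k = {0} ∧ D' k * 𝔸 * D' k = {0} ∧
    (∀ n : ℕ, ∀ x ∈ 𝔸 * C' k * 𝔸 * (D' k * 𝔸 * C' k) ^ n * 𝔸, S.E x = 0) ∧
    ∀ n : ℕ, ∀ x ∈ 𝔸 * D' k * 𝔸 * (C' k * 𝔸 * D' k) ^ n * 𝔸, S.E x = 0

/-- `θ` represents `A` on `𝒳 = B ⊕ 𝒳°` with `θ (L_b R_c) = L_b R_c` and `E (θ T) = E T`. -/
def IsRep (S : NCPS B A) (X : BBimod.{u, w} B) (θ : A →ₐ[ℂ] Module.End ℂ X.Tot) : Prop :=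
  (∀ x, θ (S.ε x) = X.space.ε x) ∧ ∀ T, X.space.E (θ T) = S.E T

/-- `(Atl k, Atr k, C' k, D' k)` is a bi-free ffb `B`-system for `S'`, and the maps
`αl k : Al k → Atl k`, `αr k : Ar k → Atr k`, `αb k : Ab k → alg (C'_k D'_k)` are `B`-linear and
preserve all joint moments of each single triple `(Al k, Ar k, Ab k)`. -/
structure IsFFBEmbedding {A' : Type*} [Ring A'] [Algebra ℂ A'] (S : NCPS B A) (S' : NCPS B A')
    (Al Ar : K → Subalgebra ℂ A) (Ab : K → NonUnitalSubalgebra ℂ A)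
    (Atl Atr : K → Subalgebra ℂ A') (C' D' : K → Set A')
    (αl : ∀ k, Al k →ₗ[ℂ] Atl k) (αr : ∀ k, Ar k →ₗ[ℂ] Atr k)
    (αb : ∀ k, Ab k →ₗ[ℂ] NonUnitalAlgebra.adjoin ℂ (C' k * D' k)) : Prop where
  system : IsFFBSystem.{u, _, w, t} S' Atl Atr C' D'
  linear_l : ∀ k b₁ b₂ (Z Z' : Al k), (Z' : A) = S.L b₁ * Z * S.L b₂ →
    (αl k Z' : A') = S'.L b₁ * αl k Z * S'.L b₂
  linear_r : ∀ k b₁ b₂ (Z Z' : Ar k), (Z' : A) = S.R b₁ * Z * S.R b₂ →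
    (αr k Z' : A') = S'.R b₁ * αr k Z * S'.R b₂
  linear_b : ∀ k b₁ b₂ (Z Z' : Ab k), (Z' : A) = S.L b₁ * Z * S.L b₂ →
    (αb k Z' : A') = S'.L b₁ * αb k Z * S'.L b₂
  moments : ∀ k, ∀ z : List (Al k ⊕ Ar k ⊕ Ab k),
    S'.E (z.map (Sum.elim (fun Z => (αl k Z : A'))
      (Sum.elim (fun Z => (αr k Z : A')) (fun Z => (αb k Z : A'))))).prod =
    S.E (z.map (Sum.elim (fun Z : Al k => (Z : A))
      (Sum.elim (fun Z : Ar k => (Z : A)) (fun Z : Ab k => (Z : A))))).prod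

/-- The system and the maps are those of the construction on `𝒴`, the reduced free product of
copies `𝒴_k` of `𝒳 ⊕ 𝒳`: `αl k Z = λ_k(D_Z)`, `αr k Z = ρ_k(D_Z)`, `αb k Z = λ_k(T_Z) ρ_k(S)`,
where `D_Z (ξ₁ ⊕ ξ₂) = θ(Z) ξ₁ ⊕ θ(Z) ξ₂`, `T_Z (ξ₁ ⊕ ξ₂) = θ(Z) ξ₂ ⊕ 0` and
`S (ξ₁ ⊕ ξ₂) = 0 ⊕ ξ₁`. The proofs `h`, `h'` say that these operators lie in `ℒ_ℓ(𝒴_k)` or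
`ℒ_r(𝒴_k)`. -/
structure IsConstruction (X : BBimod.{u, w} B) (θ : A →ₐ[ℂ] Module.End ℂ X.Tot)
    (Al Ar : K → Subalgebra ℂ A) (Ab : K → NonUnitalSubalgebra ℂ A)
    (Atl Atr : K → Subalgebra ℂ (Module.End ℂ (RedFree.prod fun _ : K => X.double).Tot))
    (C' D' : K → Set (Module.End ℂ (RedFree.prod fun _ : K => X.double).Tot))
    (αl : ∀ k, Al k →ₗ[ℂ] Atl k) (αr : ∀ k, Ar k →ₗ[ℂ] Atr k)
    (αb : ∀ k, Ab k →ₗ[ℂ] NonUnitalAlgebra.adjoin ℂ (C' k * D' k)) : Prop where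
  map_l : ∀ k (Z : Al k), ∃ h,
    (αl k Z : Module.End ℂ (RedFree.prod fun _ : K => X.double).Tot) = RedFree.lam k ⟨X.diag (θ Z), h⟩
  map_r : ∀ k (Z : Ar k), ∃ h,
    (αr k Z : Module.End ℂ (RedFree.prod fun _ : K => X.double).Tot) = RedFree.rho k ⟨X.diag (θ Z), h⟩
  map_b : ∀ k (Z : Ab k), ∃ h h',
    (αb k Z : Module.End ℂ (RedFree.prod fun _ : K => X.double).Tot) =
      RedFree.lam k ⟨X.raise (θ Z), h⟩ * RedFree.rho k ⟨X.lower, h'⟩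
  surj_l : ∀ k, Function.Surjective (αl k)
  surj_r : ∀ k, Function.Surjective (αr k)
  C'_eq : ∀ k, C' k = {T | ∃ Z ∈ Ab k, ∃ h, T = RedFree.lam k ⟨X.raise (θ Z), h⟩}
  D'_eq : ∀ k, D' k = {T | ∃ h, T = RedFree.rho k ⟨X.lower, h⟩}

end NCPS

/-! Fix `k`. Every vector of a reduced free product is a combination of vectors of its `k`-th factor
and of tensors `x ⊗ p ⊗ y`, where `x`, `y` are in the `k`-th factor (possibly equal to `1`) and `p`
is a nonempty tensor that neither starts nor ends with index `k` (`tot_induction`). On `x ⊗ p ⊗ y`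
the operator `λ_k(T)` changes only `x` and `ρ_k(T)` only `y` (`lam_lrcons`, `rho_lrcons`); on the
`k`-th factor both are `T`. Everything about operators of one index is checked on these two shapes.
In particular `λ_k` and `ρ_k` are injective homomorphisms, so faces inside their ranges are bi-free
(`isBiFree_of_le_range`).

On `𝒴_k = 𝒳 ⊕ 𝒳` each `D_Z` preserves both summands, `T_Z` maps into the first summand and kills it,
and `S` maps into the second summand and kills it. Carried to the left, respectively right, tensor
factor, this gives `C' 𝔸 C' = 0` and `D' 𝔸 D' = 0`. For the expectations, the vector `1` lies in the
first summand of `𝒴_k`, and operators of index `k` do not leave `𝒴_k`. A word of the first kind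
kills `1`, because the first element of `C'` or `D'` to act is in `C'`; a word of the second kind
sends `1` to the second summand, which has no `B`-component.

On the first summand `D_Z` and `T_Z S` both act as `θ(Z)`. Thus all three maps restrict to `θ` on a
copy of `𝒳` that contains `1` (`prod_map_embFirst`), which gives both the moments and the
injectivity.

A faithful representation is built on `W = A/N ⊕ A`, with `N` the left ideal of all `T` such that `E
(R T) = 0` for every `R` (`exists_isRep_injective`). The first summand carries `E` and identifies
`L_b` with `R_b` on the class of `1`; the second only makes the action faithful. Splitting off the
kernel of the functional `W → B` turns `W` into `B ⊕ 𝒳°`; this takes `E 1 = 1`, which is the moment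
of the empty word. -/

namespace RedFree

/-! ### Regular representations on two-sided tensors. -/

variable {B : Type u} [Ring B] [Algebra ℂ B] {K : Type t} {X : K → BBimod.{u, w} B}

theorem mk_of_not_good {l : List (Letter X)} (h : ¬ Good l) : (mk l : Circ X) = 0 :=
  mk_compat.bad l h

theorem mk_zero_mid (p q : List (Letter X)) (k : K) :
    (mk (p ++ (⟨k, 0⟩ : Letter X) :: q) : Circ X) = 0 := by
  simpa using mk_compat.smul p q k 0 0

theorem mk_zero_cons (q : List (Letter X)) (k : K) :
    (mk ((⟨k, 0⟩ : Letter X) :: q) : Circ X) = 0 := mk_zero_mid [] q k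

theorem vec_of_ne_nil {l : List (Letter X)} (h : l ≠ []) : vec l = ((0, mk l) : B × Circ X) := by
  simp [vec, h]

theorem lcons_nil (k : K) (x : (X k).Tot) : lcons k x [] = (incl k x : (prod X).Tot) := by
  ext <;> simp [lcons, vec_nil, incl]

theorem rcons_nil (k : K) (x : (X k).Tot) : rcons k x [] = (incl k x : (prod X).Tot) := by
  ext <;> simp [rcons, vec_nil, incl]

theorem lcons_one (k : K) (q : List (Letter X)) : lcons k (1, 0) q = vec q := by
  simp [lcons, mk_zero_cons]

theorem rcons_one (k : K) (q : List (Letter X)) : rcons k (1, 0) q = vec q := by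
  simp [rcons, mk_zero_mid]

theorem lcons_zero_left (k : K) (m : (X k).carrier) (q : List (Letter X)) :
    lcons k (0, m) q = vec (⟨k, m⟩ :: q) := by
  simp [lcons, vec]

/-- The lists which are a product of letters that can follow a tensor factor from `𝒳°_k`. -/
def Follows (k : K) (q : List (Letter X)) : Prop := (k :: q.map Sigma.fst).IsChain (· ≠ ·)

/-- The lists which are a product of letters that can precede a tensor factor from `𝒳°_k`. -/
def Precedes (k : K) (q : List (Letter X)) : Prop := (q.map Sigma.fst ++ [k]).IsChain (· ≠ ·)

theorem lam_apply_vec {k : K} (T : (X k).space.leftAlg) {l : List (Letter X)} (hl : Good l) :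
    lam k T (vec l) = lamFun k T.1 l := by
  rw [vec_of_ne_nil hl.1]
  simp only [lam, LinearMap.coprod_apply]
  erw [lift_mk]
  have h₀ : ((0 : B), (0 : (X k).carrier)) = 0 := rfl
  simp [onGood, hl, h₀]

theorem rho_apply_vec {k : K} (T : (X k).space.rightAlg) {l : List (Letter X)} (hl : Good l) :
    rho k T (vec l) = rhoFun k T.1 l := by
  rw [vec_of_ne_nil hl.1]
  simp only [rho, LinearMap.coprod_apply]
  erw [lift_mk]
  have h₀ : ((0 : B), (0 : (X k).carrier)) = 0 := rfl
  simp [onGood, hl, h₀]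

theorem Follows.good_cons {k : K} {q : List (Letter X)} (h : Follows k q) (m : (X k).carrier) :
    Good (⟨k, m⟩ :: q) := ⟨by simp, by simpa [Follows] using h⟩

theorem Precedes.good_concat {k : K} {q : List (Letter X)} (h : Precedes k q)
    (m : (X k).carrier) : Good (q ++ [⟨k, m⟩]) := ⟨by simp, by simpa [Precedes] using h⟩

theorem Follows.good {k : K} {q : List (Letter X)} (h : Follows k q) (hq : q ≠ []) : Good q :=
  ⟨hq, List.IsChain.of_cons h⟩

theorem Precedes.good {k : K} {q : List (Letter X)} (h : Precedes k q) (hq : q ≠ []) : Good q :=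
  ⟨hq, (List.isChain_append.1 h).1⟩

theorem smul_vec_cons (b : B) (j : K) (n : (X j).carrier) (q : List (Letter X)) :
    b • vec (⟨j, n⟩ :: q) = (vec (⟨j, b • n⟩ :: q) : B × Circ X) := by
  ext <;> simp [vec]

theorem op_smul_vec_concat (b : Bᵐᵒᵖ) (j : K) (n : (X j).carrier) (q : List (Letter X)) :
    b • vec (q ++ [⟨j, n⟩]) = (vec (q ++ [⟨j, b • n⟩]) : B × Circ X) := by
  ext <;> simp

theorem lcons_eq (k : K) (x : (X k).Tot) (q : List (Letter X)) :
    lcons k x q = (x.1 • vec q + vec (⟨k, x.2⟩ :: q) : B × Circ X) := by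
  simp [lcons, vec]

theorem rcons_eq (k : K) (x : (X k).Tot) (q : List (Letter X)) :
    rcons k x q = (op x.1 • vec q + vec (q ++ [⟨k, x.2⟩]) : B × Circ X) := by
  simp [rcons]

/-- `λ_k(T)` acts on the first factor of `x ⊗ q`. -/
theorem lam_lcons {k : K} (T : (X k).space.leftAlg) (x : (X k).Tot) {q : List (Letter X)}
    (hq : Follows k q) : lam k T (lcons k x q) = lcons k (T.1 x) q := by
  rcases q with _ | ⟨⟨j, n⟩, q⟩
  · rw [lcons_nil, lcons_nil, lam_incl]
  · have hjk : j ≠ k := by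
      have := (List.isChain_cons.1 hq).1 j (by simp)
      exact this.symm
    have h₁ : Good ((⟨j, x.1 • n⟩ : Letter X) :: q) :=
      (good_congr (by simp)).1 (hq.good (by simp))
    -- The `B`-part of `x` was absorbed into the first letter of `q`, before which `λ_k(T)` inserts
    -- `T 1`. Right `B`-linearity gives `T (x.1 ⊕ 0) = (T 1) x.1`, and balancing moves `x.1` back
    -- across the tensor sign.
    have h₂ : T.1 x = op x.1 • T.1 (1, 0) + T.1 (0, x.2) := by
      rw [← left_comm, ← map_add]
      congr 1
      ext <;> simp
    rw [lcons_eq, map_add, smul_vec_cons, lam_apply_vec T h₁, lam_apply_vec T (hq.good_cons _), h₂,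
      lcons_add, lcons_bal]
    simp [lamFun, hjk]

@[simp] theorem rho_incl (k : K) (T : (X k).space.rightAlg) (x : (X k).Tot) :
    rho k T (incl k x) = incl k (T.1 x) := by
  have h : Good [(⟨k, x.2⟩ : Letter X)] := by simp [Good]
  have h₂ : (x.1, (0 : (X k).carrier)) + (0, x.2) = x := by simp
  have h₃ : rhoFun k T.1 [(⟨k, x.2⟩ : Letter X)] = incl k (T.1 (0, x.2)) := by
    rw [← rcons_nil]
    simpa using rhoFun_concat k T.1 [] (⟨k, x.2⟩ : Letter X)
  have h₄ : (incl k x : (prod X).Tot) = (x.1, 0) + vec [⟨k, x.2⟩] := by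
    rw [vec_of_ne_nil (by simp)]
    ext <;> simp [incl]
  rw [h₄, map_add, rho_apply_vec T h, h₃]
  have h₅ : rho k T (x.1, 0) = incl k (T.1 (x.1, 0)) := by simp [rho]
  rw [h₅, ← map_add, ← map_add, h₂]

/-- `ρ_k(T)` acts on the last factor of `q ⊗ x`. -/
theorem rho_rcons {k : K} (T : (X k).space.rightAlg) (x : (X k).Tot) {q : List (Letter X)}
    (hq : Precedes k q) : rho k T (rcons k x q) = rcons k (T.1 x) q := by
  rcases List.eq_nil_or_concat q with rfl | ⟨q, ⟨j, n⟩, rfl⟩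
  · rw [rcons_nil, rcons_nil, rho_incl]
  · rw [List.concat_eq_append] at hq ⊢
    have hjk : j ≠ k := by
      have := (List.isChain_append.1 hq).2.2 j (by simp) k (by simp)
      exact this
    have h₁ : Good (q ++ [(⟨j, op x.1 • n⟩ : Letter X)]) :=
      (good_congr (by simp)).1 (hq.good (by simp))
    have h₂ : T.1 x = x.1 • T.1 (1, 0) + T.1 (0, x.2) := by
      rw [← right_comm, ← map_add]
      congr 1
      ext <;> simp
    rw [rcons_eq, map_add, op_smul_vec_concat, rho_apply_vec T h₁,
      rho_apply_vec T (hq.good_concat _), h₂, rcons_add, ← rcons_bal, rhoFun_concat, rhoFun_concat]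
    simp [hjk]

/-- `x ⊗ p ⊗ y` in `𝒳_k ⊗_B 𝒳 ⊗_B 𝒳_k`, read in `𝒳`, for a nonempty list `p` that neither starts
nor ends with `k`. -/
noncomputable def lrcons (k : K) (x : (X k).Tot) (p : List (Letter X)) (y : (X k).Tot) :
    (prod X).Tot :=
  x.1 • rcons k y p + rcons k y (⟨k, x.2⟩ :: p)

/-- The definition splits the left factor into its `B`-part and its letter, which suits `ρ_k`; this
form splits the right factor instead and suits `λ_k`. They agree because the two actions of `B`
commute. -/
theorem lrcons_eq (k : K) (x : (X k).Tot) (p : List (Letter X)) (y : (X k).Tot) :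
    lrcons k x p y = op y.1 • lcons k x p + lcons k x (p ++ [⟨k, y.2⟩]) := by
  simp only [lrcons, rcons_eq, lcons_eq, smul_add, smul_comm x.1 (op y.1), List.cons_append]
  abel

/-- Since `p` is nonempty, `b` multiplies its last letter and never reaches `x`. The new list does
not depend on `x`, so the same one serves before and after an operator acts on `x`. -/
theorem exists_op_smul_lcons (k : K) (b : Bᵐᵒᵖ) {p : List (Letter X)} (hp : p ≠ []) :
    ∃ p' : List (Letter X), p'.map Sigma.fst = p.map Sigma.fst ∧
      ∀ x : (X k).Tot, (b • lcons k x p : B × Circ X) = lcons k x p' := by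
  rcases List.eq_nil_or_concat p with rfl | ⟨p, ⟨j, n⟩, rfl⟩
  · exact absurd rfl hp
  · refine ⟨p ++ [⟨j, b • n⟩], by simp, fun x => ?_⟩
    rw [List.concat_eq_append, lcons_eq, lcons_eq, smul_add, ← smul_comm x.1 b, op_smul_vec_concat,
      ← List.cons_append, op_smul_vec_concat, List.cons_append]

theorem exists_smul_rcons (k : K) (b : B) {p : List (Letter X)} (hp : p ≠ []) :
    ∃ p' : List (Letter X), p'.map Sigma.fst = p.map Sigma.fst ∧
      ∀ x : (X k).Tot, (b • rcons k x p : B × Circ X) = rcons k x p' := by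
  rcases p with _ | ⟨⟨j, n⟩, p⟩
  · exact absurd rfl hp
  · refine ⟨⟨j, b • n⟩ :: p, by simp, fun x => ?_⟩
    rw [rcons_eq, rcons_eq, smul_add, smul_comm b, smul_vec_cons, List.cons_append,
      smul_vec_cons, List.cons_append]

/-- The nonempty lists which can stand between two tensor factors from `𝒳°_k`. -/
structure Between (k : K) (p : List (Letter X)) : Prop where
  ne_nil : p ≠ []
  chain : (k :: (p.map Sigma.fst ++ [k])).IsChain (· ≠ ·)

theorem Between.follows {k : K} {p : List (Letter X)} (h : Between k p) : Follows k p := by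
  have := h.chain
  rw [← List.cons_append] at this
  exact (List.isChain_append.1 this).1

theorem Between.precedes {k : K} {p : List (Letter X)} (h : Between k p) : Precedes k p :=
  List.IsChain.of_cons h.chain

/-- Splitting `y` leaves two tensors of the form `x ⊗ q` whose `q` does not start with `k`, and
`lam_lcons` applies to both. -/
theorem lam_lrcons {k : K} (T : (X k).space.leftAlg) (x y : (X k).Tot) {p : List (Letter X)}
    (hp : Between k p) : lam k T (lrcons k x p y) = lrcons k (T.1 x) p y := by
  obtain ⟨p', h, h'⟩ := exists_op_smul_lcons k (op y.1) hp.ne_nil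
  have h₁ : Follows k p' := by rw [Follows, h]; exact hp.follows
  have h₂ : Follows k (p ++ [⟨k, y.2⟩]) := by simpa [Follows] using hp.chain
  rw [lrcons_eq, lrcons_eq, h', h', map_add, lam_lcons T x h₁, lam_lcons T x h₂]

theorem rho_lrcons {k : K} (T : (X k).space.rightAlg) (x y : (X k).Tot) {p : List (Letter X)}
    (hp : Between k p) : rho k T (lrcons k x p y) = lrcons k x p (T.1 y) := by
  obtain ⟨p', h, h'⟩ := exists_smul_rcons k x.1 hp.ne_nil
  have h₁ : Precedes k p' := by rw [Precedes, h]; exact hp.precedes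
  have h₂ : Precedes k (⟨k, x.2⟩ :: p) := by simpa [Precedes] using hp.chain
  rw [lrcons, lrcons, h', h', map_add, rho_rcons T y h₁, rho_rcons T y h₂]

theorem smul_lcons (k : K) (b : B) (x : (X k).Tot) (q : List (Letter X)) :
    (b • lcons k x q : B × Circ X) = lcons k (b • x) q := by
  rw [lcons_eq, lcons_eq, smul_add, smul_vec_cons, smul_smul]; rfl

theorem op_smul_rcons (k : K) (b : Bᵐᵒᵖ) (x : (X k).Tot) (q : List (Letter X)) :
    (b • rcons k x q : B × Circ X) = rcons k (b • x) q := by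
  rw [rcons_eq, rcons_eq, smul_add, op_smul_vec_concat, smul_smul]; rfl

theorem smul_lrcons (k : K) (b : B) (x y : (X k).Tot) (p : List (Letter X)) :
    b • lrcons k x p y = lrcons k (b • x) p y := by
  rw [lrcons_eq, lrcons_eq, smul_add, smul_comm b, smul_lcons, smul_lcons]

theorem op_smul_lrcons (k : K) (b : Bᵐᵒᵖ) (x y : (X k).Tot) (p : List (Letter X)) :
    b • lrcons k x p y = lrcons k x p (b • y) := by
  rw [lrcons, lrcons, smul_add, ← smul_comm x.1 b, op_smul_rcons, op_smul_rcons]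

theorem smul_incl (k : K) (b : B) (x : (X k).Tot) :
    b • (incl k x : (prod X).Tot) = incl k (b • x) := by
  rw [← lcons_nil, ← lcons_nil, smul_lcons]

theorem op_smul_incl (k : K) (b : Bᵐᵒᵖ) (x : (X k).Tot) :
    b • (incl k x : (prod X).Tot) = incl k (b • x) := by
  rw [← rcons_nil, ← rcons_nil, op_smul_rcons]

theorem lrcons_add_left (k : K) (x x' y : (X k).Tot) (p : List (Letter X)) :
    lrcons k (x + x') p y = lrcons k x p y + lrcons k x' p y := by
  simp only [lrcons_eq, lcons_add, smul_add]; abel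

theorem lrcons_add_right (k : K) (x y y' : (X k).Tot) (p : List (Letter X)) :
    lrcons k x p (y + y') = lrcons k x p y + lrcons k x p y' := by
  simp only [lrcons, rcons_add, smul_add]; abel

theorem lrcons_smul_left (k : K) (c : ℂ) (x y : (X k).Tot) (p : List (Letter X)) :
    lrcons k (c • x) p y = c • lrcons k x p y := by
  simp only [lrcons_eq, lcons_smul, smul_add, smul_comm (op y.1) c]

theorem lrcons_smul_right (k : K) (c : ℂ) (x y : (X k).Tot) (p : List (Letter X)) :
    lrcons k x p (c • y) = c • lrcons k x p y := by
  simp only [lrcons, rcons_smul, smul_add, smul_comm x.1 c]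

theorem lrcons_zero_left (k : K) (y : (X k).Tot) (p : List (Letter X)) :
    lrcons k 0 p y = 0 := by
  simpa using lrcons_smul_left k 0 0 y p

theorem lrcons_zero_right (k : K) (x : (X k).Tot) (p : List (Letter X)) :
    lrcons k x p 0 = 0 := by
  simpa using lrcons_smul_right k 0 x 0 p

/-- If the last letter of `q` has index `k`, it becomes the right factor `y`, and what precedes it
is nonempty because `q` cannot start with `k`. Otherwise `y = 1`. -/
theorem lcons_eq_incl_or_lrcons (k : K) (x : (X k).Tot) {q : List (Letter X)}
    (hq : Follows k q) : (∃ z, lcons k x q = (incl k z : (prod X).Tot)) ∨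
      ∃ p, Between k p ∧ ∃ y, (lcons k x q : (prod X).Tot) = lrcons k x p y := by
  rcases List.eq_nil_or_concat q with rfl | ⟨q, ⟨j, n⟩, rfl⟩
  · exact .inl ⟨x, lcons_nil k x⟩
  rw [List.concat_eq_append] at hq ⊢
  right
  by_cases hj : j = k
  · subst hj
    refine ⟨q, ⟨?_, by simpa [Follows] using hq⟩, (0, n), ?_⟩
    · rintro rfl
      simp [Follows] at hq
    · simp [lrcons_eq]
  · refine ⟨q ++ [⟨j, n⟩], ⟨by simp, ?_⟩, (1, 0), ?_⟩
    · rw [← List.cons_append, List.isChain_append]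
      exact ⟨hq, by simp, by
        intro a ha b hb
        simp only [List.map_append, List.map_cons, List.map_nil, ← List.cons_append,
          List.getLast?_concat, List.head?_cons, Option.mem_def, Option.some.injEq] at ha hb
        subst ha hb
        exact hj⟩
    · rw [lrcons, rcons_one, rcons_one, lcons_eq]

/-- The vectors `x ∈ 𝒳_k` and `x ⊗ p ⊗ y` span `𝒳`. -/
theorem tot_induction (k : K) {P : (prod X).Tot → Prop} (add : ∀ v w, P v → P w → P (v + w))
    (smul : ∀ (c : ℂ) v, P v → P (c • v)) (incl : ∀ x, P (incl k x))
    (lrcons : ∀ x p y, Between k p → P (lrcons k x p y)) (v : (prod X).Tot) : P v := by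
  have h₀ : ∀ x q, Follows k q → P (lcons k x q) := fun x q hq => by
    rcases lcons_eq_incl_or_lrcons k x hq with ⟨z, hz⟩ | ⟨p, hp, y, hy⟩
    · exact hz ▸ incl z
    · exact hy ▸ lrcons x p y hp
  let N : Submodule ℂ (prod X).Tot :=
    { carrier := {v | P v}
      add_mem' := fun {a b} => add a b
      zero_mem' := by simpa using incl 0
      smul_mem' := smul }
  -- Elementary tensors span `𝒳°`, so it is enough that the quotient map by `N` kills them. A good
  -- tensor that does not start with `k` is read as `1 ⊗ l`.
  have h₁ : LinearMap.comp N.mkQ (LinearMap.inr ℂ B (Circ X)) = 0 := hom_ext fun l => by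
    change N.mkQ (0, mk l) = 0
    rw [Submodule.mkQ_apply, Submodule.Quotient.mk_eq_zero]
    by_cases hl : Good l
    · rw [← vec_of_ne_nil hl.1]
      rcases l with _ | ⟨⟨j, n⟩, q⟩
      · exact absurd rfl hl.1
      · by_cases hj : j = k
        · subst hj
          rw [← lcons_zero_left]
          exact h₀ _ _ (by simpa [Follows] using hl.2)
        · rw [← lcons_one k]
          exact h₀ _ _ (List.isChain_cons.2 ⟨by simpa using Ne.symm hj, hl.2⟩)
    · rw [mk_of_not_good hl]
      exact N.zero_mem
  have h₂ : v = RedFree.incl k (v.1, 0) + (0, v.2) := by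
    ext <;> simp [RedFree.incl, mk_zero_cons]
  rw [h₂]
  refine add _ _ (incl _) ?_
  have := LinearMap.congr_fun h₁ v.2
  exact (Submodule.Quotient.mk_eq_zero N).1 this

/-- The form in which `tot_induction` is used for operator identities: each reduces to one check on
`𝒳_k` and one on `x ⊗ p ⊗ y`. -/
theorem end_ext (k : K) {N : Type*} [AddCommGroup N] [Module ℂ N] {f g : (prod X).Tot →ₗ[ℂ] N}
    (h : ∀ x, f (incl k x) = g (incl k x))
    (h' : ∀ x p y, Between k p → f (lrcons k x p y) = g (lrcons k x p y)) : f = g :=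
  LinearMap.ext <| tot_induction k (fun v w hv hw => by rw [map_add, map_add, hv, hw])
    (fun c v hv => by rw [map_smul, map_smul, hv]) h h'

theorem incl_injective (k : K) : Function.Injective (incl k : (X k).Tot → (prod X).Tot) :=
  Function.LeftInverse.injective (g := proj k) (proj_incl k)

/-- The left regular representation as a homomorphism. -/
noncomputable def lamHom (k : K) : (X k).space.leftAlg →ₐ[ℂ] Module.End ℂ (prod X).Tot :=
  AlgHom.ofLinearMap
    { toFun := lam k
      map_add' := fun S T => end_ext k (fun x => by simp)
        (fun x p y hp => by simp [lam_lrcons _ _ _ hp, lrcons_add_left])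
      map_smul' := fun c T => end_ext k (fun x => by simp)
        (fun x p y hp => by simp [lam_lrcons _ _ _ hp, lrcons_smul_left]) }
    (end_ext k (fun x => by simp) (fun x p y hp => by simp [lam_lrcons _ _ _ hp]))
    (fun S T => end_ext k (fun x => by simp)
        (fun x p y hp => by simp [lam_lrcons _ _ _ hp]))

/-- The right regular representation as a homomorphism. -/
noncomputable def rhoHom (k : K) : (X k).space.rightAlg →ₐ[ℂ] Module.End ℂ (prod X).Tot :=
  AlgHom.ofLinearMap
    { toFun := rho k
      map_add' := fun S T => end_ext k (fun x => by simp)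
        (fun x p y hp => by simp [rho_lrcons _ _ _ hp, lrcons_add_right])
      map_smul' := fun c T => end_ext k (fun x => by simp)
        (fun x p y hp => by simp [rho_lrcons _ _ _ hp, lrcons_smul_right]) }
    (end_ext k (fun x => by simp) (fun x p y hp => by simp [rho_lrcons _ _ _ hp]))
    (fun S T => end_ext k (fun x => by simp)
        (fun x p y hp => by simp [rho_lrcons _ _ _ hp]))

theorem lamHom_apply (k : K) (T : (X k).space.leftAlg) : lamHom k T = lam k T := rfl

theorem rhoHom_apply (k : K) (T : (X k).space.rightAlg) : rhoHom k T = rho k T := rfl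

/-- The restriction of `λ_k(T)` to the copy of `𝒳_k` in `𝒳` is `T`. -/
theorem lamHom_injective (k : K) : Function.Injective (lamHom (X := X) k) := fun S T h =>
  Subtype.ext <| LinearMap.ext fun x => incl_injective k <| by
    simpa [lamHom_apply] using LinearMap.congr_fun h (incl k x)

theorem rhoHom_injective (k : K) : Function.Injective (rhoHom (X := X) k) := fun S T h =>
  Subtype.ext <| LinearMap.ext fun x => incl_injective k <| by
    simpa [rhoHom_apply] using LinearMap.congr_fun h (incl k x)

end RedFree

/-! ### Left and right algebras as one-sided module maps. -/

namespace BBimod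

variable {B : Type u} [Ring B] [Algebra ℂ B] (X : BBimod.{u, w} B)

@[simp] theorem space_L_apply (b : B) (x : X.Tot) : X.space.L b x = b • x := by
  simp [NCPS.L, space]

@[simp] theorem space_R_apply (b : B) (x : X.Tot) : X.space.R b x = op b • x := by
  simp [NCPS.R, space]

theorem space_E_apply (T : Module.End ℂ X.Tot) : X.space.E T = (T (1, 0)).1 := rfl

variable {X} in
theorem mem_leftAlg_iff {T : Module.End ℂ X.Tot} :
    T ∈ X.space.leftAlg ↔ ∀ (b : B) x, T (op b • x) = op b • T x := by
  refine ⟨fun h => RedFree.left_comm ⟨T, h⟩, fun h => ?_⟩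
  refine (Subalgebra.mem_centralizer_iff ℂ).2 ?_
  rintro _ ⟨b, rfl⟩
  exact LinearMap.ext fun x => by simp [h]

variable {X} in
theorem mem_rightAlg_iff {T : Module.End ℂ X.Tot} :
    T ∈ X.space.rightAlg ↔ ∀ (b : B) x, T (b • x) = b • T x := by
  refine ⟨fun h => RedFree.right_comm ⟨T, h⟩, fun h => ?_⟩
  refine (Subalgebra.mem_centralizer_iff ℂ).2 ?_
  rintro _ ⟨b, rfl⟩
  exact LinearMap.ext fun x => by simp [h]

theorem L_mem_leftAlg (b : B) : X.space.L b ∈ X.space.leftAlg :=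
  mem_leftAlg_iff.2 fun c x => by simp [smul_comm]

theorem R_mem_rightAlg (b : B) : X.space.R b ∈ X.space.rightAlg :=
  mem_rightAlg_iff.2 fun c x => by simp [smul_comm]

end BBimod

/-- The endomorphisms that leave a submodule invariant. -/
def Submodule.endStabilizer {V : Type*} [AddCommGroup V] [Module ℂ V] (N : Submodule ℂ V) :
    Subalgebra ℂ (Module.End ℂ V) where
  carrier := {T | ∀ v ∈ N, T v ∈ N}
  mul_mem' hS hT v hv := hS _ (hT v hv)
  add_mem' hS hT v hv := N.add_mem (hS v hv) (hT v hv)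
  algebraMap_mem' c v hv := by simpa [Module.algebraMap_end_apply] using N.smul_mem c hv

/-! ### Linearity, invariant subspaces and bi-freeness of the regular representations. -/

namespace RedFree

variable {B : Type u} [Ring B] [Algebra ℂ B] {K : Type t} {X : K → BBimod.{u, w} B}

/-- On `x ⊗ p ⊗ y` the operator acts on `x` and the right action of `B` on `y`. Only on `𝒳_k` do
they meet, and there `T` is right `B`-linear. -/
theorem lam_mem_leftAlg (k : K) (T : (X k).space.leftAlg) :
    lam k T ∈ (prod X).space.leftAlg :=
  (Subalgebra.mem_centralizer_iff ℂ).2 <| by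
    rintro _ ⟨b, rfl⟩
    exact end_ext k (fun x => by simp [op_smul_incl, left_comm])
      (fun x p y hp => by simp [op_smul_lrcons, lam_lrcons _ _ _ hp])

theorem rho_mem_rightAlg (k : K) (T : (X k).space.rightAlg) :
    rho k T ∈ (prod X).space.rightAlg :=
  (Subalgebra.mem_centralizer_iff ℂ).2 <| by
    rintro _ ⟨b, rfl⟩
    exact end_ext k (fun x => by simp [smul_incl, right_comm])
      (fun x p y hp => by simp [smul_lrcons, rho_lrcons _ _ _ hp])

/-- `ρ_k(T)` is a right `B`-module map if `T` is. -/
theorem rho_mem_leftAlg (k : K) (T : (X k).space.rightAlg) (hT : T.1 ∈ (X k).space.leftAlg) :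
    rho k T ∈ (prod X).space.leftAlg :=
  (Subalgebra.mem_centralizer_iff ℂ).2 <| by
    rintro _ ⟨b, rfl⟩
    exact end_ext k (fun x => by simp [op_smul_incl, BBimod.mem_leftAlg_iff.1 hT])
      (fun x p y hp => by
        simp [op_smul_lrcons, rho_lrcons _ _ _ hp, BBimod.mem_leftAlg_iff.1 hT])

/-- This puts `L_b` in the range of every `λ_k`, so that faces inside the range can contain all
`L_b` and products with `L_b` can be computed in `𝒳_k`. -/
theorem lam_L (k : K) (b : B) :
    lam k ⟨(X k).space.L b, (X k).L_mem_leftAlg b⟩ = (prod X).space.L b :=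
  end_ext k (fun x => by simp [smul_incl])
    (fun x p y hp => by simp [smul_lrcons, lam_lrcons _ _ _ hp])

theorem rho_R (k : K) (b : B) :
    rho k ⟨(X k).space.R b, (X k).R_mem_rightAlg b⟩ = (prod X).space.R b :=
  end_ext k (fun x => by simp [op_smul_incl])
    (fun x p y hp => by simp [op_smul_lrcons, rho_lrcons _ _ _ hp])

/-- The vectors of `𝒳 ≅ 𝒳_k ⊗_B 𝒳_ℓ(k)` whose first factor lies in `N`. -/
noncomputable def leftPart (k : K) (N : Submodule ℂ (X k).Tot) : Submodule ℂ (prod X).Tot :=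
  Submodule.span ℂ ({v | ∃ x ∈ N, incl k x = v} ∪
    {v | ∃ x ∈ N, ∃ p y, Between k p ∧ lrcons k x p y = v})

/-- The vectors of `𝒳 ≅ 𝒳_r(k) ⊗_B 𝒳_k` whose last factor lies in `N`. -/
noncomputable def rightPart (k : K) (N : Submodule ℂ (X k).Tot) : Submodule ℂ (prod X).Tot :=
  Submodule.span ℂ ({v | ∃ y ∈ N, incl k y = v} ∪
    {v | ∃ y ∈ N, ∃ p x, Between k p ∧ lrcons k x p y = v})

section parts

variable {k : K} {N : Submodule ℂ (X k).Tot}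

theorem incl_mem_leftPart {x : (X k).Tot} (hx : x ∈ N) : incl k x ∈ leftPart k N :=
  Submodule.subset_span (.inl ⟨x, hx, rfl⟩)

theorem lrcons_mem_leftPart {x : (X k).Tot} (hx : x ∈ N) {p : List (Letter X)} (y : (X k).Tot)
    (hp : Between k p) : lrcons k x p y ∈ leftPart k N :=
  Submodule.subset_span (.inr ⟨x, hx, p, y, hp, rfl⟩)

theorem incl_mem_rightPart {y : (X k).Tot} (hy : y ∈ N) : incl k y ∈ rightPart k N :=
  Submodule.subset_span (.inl ⟨y, hy, rfl⟩)

theorem lrcons_mem_rightPart {y : (X k).Tot} (hy : y ∈ N) {p : List (Letter X)} (x : (X k).Tot)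
    (hp : Between k p) : lrcons k x p y ∈ rightPart k N :=
  Submodule.subset_span (.inr ⟨y, hy, p, x, hp, rfl⟩)

theorem leftPart_le {M : Submodule ℂ (prod X).Tot} (h : ∀ x ∈ N, incl k x ∈ M)
    (h' : ∀ x ∈ N, ∀ p y, Between k p → lrcons k x p y ∈ M) : leftPart k N ≤ M := by
  refine Submodule.span_le.2 ?_
  rintro _ (⟨x, hx, rfl⟩ | ⟨x, hx, p, y, hp, rfl⟩)
  exacts [h x hx, h' x hx p y hp]

theorem rightPart_le {M : Submodule ℂ (prod X).Tot} (h : ∀ y ∈ N, incl k y ∈ M)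
    (h' : ∀ y ∈ N, ∀ p x, Between k p → lrcons k x p y ∈ M) : rightPart k N ≤ M := by
  refine Submodule.span_le.2 ?_
  rintro _ (⟨x, hx, rfl⟩ | ⟨x, hx, p, y, hp, rfl⟩)
  exacts [h x hx, h' x hx p y hp]

theorem lam_mem_endStabilizer_leftPart (T : (X k).space.leftAlg) (hT : T.1 ∈ N.endStabilizer) :
    lam k T ∈ (leftPart k N).endStabilizer :=
  leftPart_le (M := (leftPart k N).comap (lam k T))
    (fun x hx => by simpa using incl_mem_leftPart (hT x hx))
    (fun x hx p y hp => by
      simpa [lam_lrcons _ _ _ hp] using lrcons_mem_leftPart (hT x hx) y hp)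

/-- On `x ⊗ p ⊗ y` the left factor is untouched. Invariance of `N` under `T` matters on `𝒳_k`, where
the only factor is both first and last. -/
theorem rho_mem_endStabilizer_leftPart (T : (X k).space.rightAlg) (hT : T.1 ∈ N.endStabilizer) :
    rho k T ∈ (leftPart k N).endStabilizer :=
  leftPart_le (M := (leftPart k N).comap (rho k T))
    (fun x hx => by simpa using incl_mem_leftPart (hT x hx))
    (fun x hx p y hp => by
      simpa [rho_lrcons _ _ _ hp] using lrcons_mem_leftPart hx (T.1 y) hp)

theorem lam_mem_endStabilizer_rightPart (T : (X k).space.leftAlg) (hT : T.1 ∈ N.endStabilizer) :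
    lam k T ∈ (rightPart k N).endStabilizer :=
  rightPart_le (M := (rightPart k N).comap (lam k T))
    (fun x hx => by simpa using incl_mem_rightPart (hT x hx))
    (fun y hy p x hp => by
      simpa [lam_lrcons _ _ _ hp] using lrcons_mem_rightPart hy (T.1 x) hp)

theorem rho_mem_endStabilizer_rightPart (T : (X k).space.rightAlg) (hT : T.1 ∈ N.endStabilizer) :
    rho k T ∈ (rightPart k N).endStabilizer :=
  rightPart_le (M := (rightPart k N).comap (rho k T))
    (fun x hx => by simpa using incl_mem_rightPart (hT x hx))
    (fun y hy p x hp => by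
      simpa [rho_lrcons _ _ _ hp] using lrcons_mem_rightPart (hT y hy) x hp)

theorem lam_apply_mem_leftPart (T : (X k).space.leftAlg) (hT : ∀ x, T.1 x ∈ N)
    (v : (prod X).Tot) : lam k T v ∈ leftPart k N :=
  tot_induction k (P := fun v => lam k T v ∈ leftPart k N)
    (fun v w hv hw => by rw [map_add]; exact add_mem hv hw)
    (fun c v hv => by rw [map_smul]; exact Submodule.smul_mem _ c hv)
    (fun x => by simpa using incl_mem_leftPart (hT x))
    (fun x p y hp => by simpa [lam_lrcons _ _ _ hp] using lrcons_mem_leftPart (hT x) y hp) v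

theorem rho_apply_mem_rightPart (T : (X k).space.rightAlg) (hT : ∀ x, T.1 x ∈ N)
    (v : (prod X).Tot) : rho k T v ∈ rightPart k N :=
  tot_induction k (P := fun v => rho k T v ∈ rightPart k N)
    (fun v w hv hw => by rw [map_add]; exact add_mem hv hw)
    (fun c v hv => by rw [map_smul]; exact Submodule.smul_mem _ c hv)
    (fun x => by simpa using incl_mem_rightPart (hT x))
    (fun x p y hp => by simpa [rho_lrcons _ _ _ hp] using lrcons_mem_rightPart (hT y) x hp) v

theorem lam_eq_zero_of_mem_leftPart (T : (X k).space.leftAlg) (hT : ∀ x ∈ N, T.1 x = 0)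
    {v : (prod X).Tot} (hv : v ∈ leftPart k N) : lam k T v = 0 :=
  leftPart_le (M := LinearMap.ker (lam k T)) (fun x hx => by simp [hT x hx])
    (fun x hx p y hp => by simp [lam_lrcons _ _ _ hp, hT x hx, lrcons_zero_left]) hv

theorem rho_eq_zero_of_mem_rightPart (T : (X k).space.rightAlg) (hT : ∀ x ∈ N, T.1 x = 0)
    {v : (prod X).Tot} (hv : v ∈ rightPart k N) : rho k T v = 0 :=
  rightPart_le (M := LinearMap.ker (rho k T)) (fun x hx => by simp [hT x hx])
    (fun x hx p y hp => by simp [rho_lrcons _ _ _ hp, hT x hx, lrcons_zero_right]) hv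

theorem lam_mem_endStabilizer_map (T : (X k).space.leftAlg) (hT : T.1 ∈ N.endStabilizer) :
    lam k T ∈ (N.map (incl k : (X k).Tot →ₗ[ℂ] (prod X).Tot)).endStabilizer := by
  rintro _ ⟨x, hx, rfl⟩
  exact ⟨T.1 x, hT x hx, (lam_incl k T x).symm⟩

theorem rho_mem_endStabilizer_map (T : (X k).space.rightAlg) (hT : T.1 ∈ N.endStabilizer) :
    rho k T ∈ (N.map (incl k : (X k).Tot →ₗ[ℂ] (prod X).Tot)).endStabilizer := by
  rintro _ ⟨x, hx, rfl⟩
  exact ⟨T.1 x, hT x hx, (rho_incl k T x).symm⟩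

end parts

theorem range_lamHom_le_leftAlg (k : K) :
    (lamHom (X := X) k).range ≤ (prod X).space.leftAlg := by
  rintro _ ⟨T, rfl⟩
  exact lam_mem_leftAlg k T

theorem range_rhoHom_le_rightAlg (k : K) :
    (rhoHom (X := X) k).range ≤ (prod X).space.rightAlg := by
  rintro _ ⟨T, rfl⟩
  exact rho_mem_rightAlg k T

/-- The inverses of the injective maps `λ_k` and `ρ_k` on their ranges serve as `ℓ_k` and `r_k` for
the same bimodules. Representing an element then returns that element, so the two joint moments are
the same expression. -/
theorem isBiFree_of_le_range {C D : K → Subalgebra ℂ (Module.End ℂ (prod X).Tot)}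
    (hCD : ∀ k, (prod X).space.IsPair (C k) (D k)) (hC : ∀ k, C k ≤ (lamHom k).range)
    (hD : ∀ k, D k ≤ (rhoHom k).range) :
    NCPS.IsBiFree.{u, max u t w, w, t} (prod X).space C D := by
  let e (k) := AlgEquiv.ofInjective (lamHom (X := X) k) (lamHom_injective k)
  let f (k) := AlgEquiv.ofInjective (rhoHom (X := X) k) (rhoHom_injective k)
  refine ⟨hCD, X, fun k => (e k).symm.toAlgHom.comp (Subalgebra.inclusion (hC k)),
    fun k => (f k).symm.toAlgHom.comp (Subalgebra.inclusion (hD k)), fun z => ?_⟩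
  have he (k) (c : C k) : lam k ((e k).symm (Subalgebra.inclusion (hC k) c)) = c :=
    congrArg Subtype.val ((e k).apply_symm_apply (Subalgebra.inclusion (hC k) c))
  have hf (k) (c : D k) : rho k ((f k).symm (Subalgebra.inclusion (hD k) c)) = c :=
    congrArg Subtype.val ((f k).apply_symm_apply (Subalgebra.inclusion (hD k) c))
  congr 3
  funext a
  rcases a with ⟨k, c | c⟩
  · exact (he k c).symm
  · exact (hf k c).symm

end RedFree

/-! ### The operators `D_Z`, `T_Z` and `S` on `𝒳 ⊕ 𝒳`. -/

namespace BBimod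

variable {B : Type u} [Ring B] [Algebra ℂ B] (X : BBimod.{u, w} B)

theorem split_smul (b : B) (y : X.double.Tot) : X.split (b • y) = b • X.split y := rfl

theorem split_op_smul (b : Bᵐᵒᵖ) (y : X.double.Tot) : X.split (b • y) = b • X.split y := rfl

@[simp] theorem split_diag (T : Module.End ℂ X.Tot) (y : X.double.Tot) :
    X.split (X.diag T y) = (T (X.split y).1, T (X.split y).2) := by
  simp [diag]

@[simp] theorem split_raise (T : Module.End ℂ X.Tot) (y : X.double.Tot) :
    X.split (X.raise T y) = (T (X.split y).2, 0) := by
  simp [raise]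

@[simp] theorem split_lower (y : X.double.Tot) : X.split (X.lower y) = (0, (X.split y).1) := by
  simp [lower]

variable {X} in
theorem double_end_ext {S T : Module.End ℂ X.double.Tot}
    (h : ∀ y, X.split (S y) = X.split (T y)) : S = T :=
  LinearMap.ext fun y => X.split.injective (h y)

variable {X}

theorem diag_mem_leftAlg {T : Module.End ℂ X.Tot} (hT : T ∈ X.space.leftAlg) :
    X.diag T ∈ X.double.space.leftAlg :=
  mem_leftAlg_iff.2 fun b y => X.split.injective <| by
    simp [split_op_smul, mem_leftAlg_iff.1 hT]

theorem diag_mem_rightAlg {T : Module.End ℂ X.Tot} (hT : T ∈ X.space.rightAlg) :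
    X.diag T ∈ X.double.space.rightAlg :=
  mem_rightAlg_iff.2 fun b y => X.split.injective <| by
    simp [split_smul, mem_rightAlg_iff.1 hT]

theorem raise_mem_leftAlg {T : Module.End ℂ X.Tot} (hT : T ∈ X.space.leftAlg) :
    X.raise T ∈ X.double.space.leftAlg :=
  mem_leftAlg_iff.2 fun b y => X.split.injective <| by
    simp [split_op_smul, mem_leftAlg_iff.1 hT]

variable (X)

/-- `S` only permutes copies of `𝒳`, so it is linear for both actions. The right one is what places
`ρ_k(S)` in the left algebra, as a bi-free ffb system requires of `D'`. -/
theorem lower_mem_leftAlg : X.lower ∈ X.double.space.leftAlg :=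
  mem_leftAlg_iff.2 fun b y => X.split.injective <| by simp [split_op_smul]

theorem lower_mem_rightAlg : X.lower ∈ X.double.space.rightAlg :=
  mem_rightAlg_iff.2 fun b y => X.split.injective <| by simp [split_smul]

/-- The first summand of `𝒴 = 𝒳 ⊕ 𝒳`. -/
noncomputable def firstPart : Submodule ℂ X.double.Tot :=
  LinearMap.ker (LinearMap.snd ℂ X.Tot X.Tot ∘ₗ X.split.toLinearMap)

/-- The second summand of `𝒴 = 𝒳 ⊕ 𝒳`. -/
noncomputable def secondPart : Submodule ℂ X.double.Tot :=
  LinearMap.ker (LinearMap.fst ℂ X.Tot X.Tot ∘ₗ X.split.toLinearMap)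

variable {X}

@[simp] theorem mem_firstPart {y : X.double.Tot} : y ∈ X.firstPart ↔ (X.split y).2 = 0 := by
  simp [firstPart]

@[simp] theorem mem_secondPart {y : X.double.Tot} : y ∈ X.secondPart ↔ (X.split y).1 = 0 := by
  simp [secondPart]

theorem diag_mem_endStabilizer_firstPart (T : Module.End ℂ X.Tot) :
    X.diag T ∈ X.firstPart.endStabilizer := fun y hy => by
  rw [mem_firstPart] at hy ⊢
  simp [hy]

theorem diag_mem_endStabilizer_secondPart (T : Module.End ℂ X.Tot) :
    X.diag T ∈ X.secondPart.endStabilizer := fun y hy => by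
  rw [mem_secondPart] at hy ⊢
  simp [hy]

theorem raise_mem_firstPart (T : Module.End ℂ X.Tot) (y : X.double.Tot) :
    X.raise T y ∈ X.firstPart := by simp

theorem raise_eq_zero (T : Module.End ℂ X.Tot) {y : X.double.Tot} (hy : y ∈ X.firstPart) :
    X.raise T y = 0 := X.split.injective <| by
  rw [mem_firstPart] at hy
  simp [hy]

theorem lower_mem_secondPart (y : X.double.Tot) : X.lower y ∈ X.secondPart := by simp

theorem lower_eq_zero {y : X.double.Tot} (hy : y ∈ X.secondPart) : X.lower y = 0 :=
  X.split.injective <| by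
    rw [mem_secondPart] at hy
    simp [hy]

theorem one_mem_firstPart : ((1, 0) : X.double.Tot) ∈ X.firstPart :=
  mem_firstPart.2 rfl

theorem fst_eq_zero_of_mem_secondPart {y : X.double.Tot} (hy : y ∈ X.secondPart) : y.1 = 0 :=
  congrArg Prod.fst (mem_secondPart.1 hy)

end BBimod

/-! ### The bi-free ffb system on `𝒴`. -/

namespace NCPS

open RedFree

variable {B : Type u} [Ring B] [Algebra ℂ B] {A : Type v} [Ring A] [Algebra ℂ A] {K : Type t}
  {S : NCPS B A} {Al Ar : K → Subalgebra ℂ A} {Ab : K → NonUnitalSubalgebra ℂ A}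
  {X : BBimod.{u, w} B} {θ : A →ₐ[ℂ] Module.End ℂ X.Tot}

theorem IsRep.map_L (h : S.IsRep X θ) (b : B) : θ (S.L b) = X.space.L b := h.1 _

theorem IsRep.map_R (h : S.IsRep X θ) (b : B) : θ (S.R b) = X.space.R b := h.1 _

theorem L_one (S : NCPS B A) : S.L 1 = 1 := map_one S.ε

theorem IsRep.map_mem_leftAlg (h : S.IsRep X θ) {Z : A} (hZ : Z ∈ S.leftAlg) :
    θ Z ∈ X.space.leftAlg :=
  (Subalgebra.mem_centralizer_iff ℂ).2 <| by
    rintro _ ⟨b, rfl⟩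
    rw [← h.map_R, ← map_mul, ← map_mul, (Subalgebra.mem_centralizer_iff ℂ).1 hZ _ ⟨b, rfl⟩]

theorem IsRep.map_mem_rightAlg (h : S.IsRep X θ) {Z : A} (hZ : Z ∈ S.rightAlg) :
    θ Z ∈ X.space.rightAlg :=
  (Subalgebra.mem_centralizer_iff ℂ).2 <| by
    rintro _ ⟨b, rfl⟩
    rw [← h.map_L, ← map_mul, ← map_mul, (Subalgebra.mem_centralizer_iff ℂ).1 hZ _ ⟨b, rfl⟩]

theorem IsPair.mono {C C' D D' : Subalgebra ℂ A} (h : S.IsPair C D) (hC : C ≤ C')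
    (hC' : C' ≤ S.leftAlg) (hD : D ≤ D') (hD' : D' ≤ S.rightAlg) : S.IsPair C' D' :=
  ⟨⟨fun b => hC (h.1.1 b), hC'⟩, fun b => hD (h.2.1 b), hD'⟩

/-- `𝒴`, the reduced free product of copies of `𝒳 ⊕ 𝒳`. -/
noncomputable abbrev doubleProd (K : Type t) (X : BBimod.{u, w} B) : BBimod.{u, max t u w} B :=
  RedFree.prod fun _ : K => X.double

/-- `Z ↦ λ_k(D_Z)`. -/
noncomputable def diagLeft (h : S.IsRep X θ) (hl : ∀ k, Al k ≤ S.leftAlg) (k : K) :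
    Al k →ₐ[ℂ] Module.End ℂ (doubleProd K X).Tot :=
  (lamHom (X := fun _ : K => X.double) k).comp
    (AlgHom.ofLinearMap
      { toFun := fun Z =>
          ⟨X.diag (θ Z), BBimod.diag_mem_leftAlg (h.map_mem_leftAlg (hl k Z.2))⟩
        map_add' := fun Z Z' => Subtype.ext <| BBimod.double_end_ext fun y => by simp
        map_smul' := fun c Z => Subtype.ext <| BBimod.double_end_ext fun y => by simp }
      (Subtype.ext <| BBimod.double_end_ext fun y => by simp)
      fun Z Z' => Subtype.ext <| BBimod.double_end_ext fun y => by simp)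

/-- `Z ↦ ρ_k(D_Z)`. -/
noncomputable def diagRight (h : S.IsRep X θ) (hr : ∀ k, Ar k ≤ S.rightAlg) (k : K) :
    Ar k →ₐ[ℂ] Module.End ℂ (doubleProd K X).Tot :=
  (rhoHom (X := fun _ : K => X.double) k).comp
    (AlgHom.ofLinearMap
      { toFun := fun Z =>
          ⟨X.diag (θ Z), BBimod.diag_mem_rightAlg (h.map_mem_rightAlg (hr k Z.2))⟩
        map_add' := fun Z Z' => Subtype.ext <| BBimod.double_end_ext fun y => by simp
        map_smul' := fun c Z => Subtype.ext <| BBimod.double_end_ext fun y => by simp }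
      (Subtype.ext <| BBimod.double_end_ext fun y => by simp)
      fun Z Z' => Subtype.ext <| BBimod.double_end_ext fun y => by simp)

/-- `Z ↦ λ_k(T_Z)`. -/
noncomputable def raiseLeft (h : S.IsRep X θ) (hb : ∀ k, ∀ d ∈ Ab k, d ∈ S.leftAlg) (k : K) :
    Ab k →ₗ[ℂ] Module.End ℂ (doubleProd K X).Tot :=
  (lamHom (X := fun _ : K => X.double) k).toLinearMap ∘ₗ
    { toFun := fun Z =>
        ⟨X.raise (θ Z), BBimod.raise_mem_leftAlg (h.map_mem_leftAlg (hb k Z Z.2))⟩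
      map_add' := fun Z Z' => Subtype.ext <| BBimod.double_end_ext fun y => by simp
      map_smul' := fun c Z => Subtype.ext <| BBimod.double_end_ext fun y => by simp }

/-- `ρ_k(S)`. -/
noncomputable def lowerRight (X : BBimod.{u, w} B) (k : K) :
    Module.End ℂ (doubleProd K X).Tot :=
  rho (X := fun _ : K => X.double) k ⟨X.lower, X.lower_mem_rightAlg⟩

section

variable (h : S.IsRep X θ) (hl : ∀ k, Al k ≤ S.leftAlg) (hr : ∀ k, Ar k ≤ S.rightAlg)
  (hb : ∀ k, ∀ d ∈ Ab k, d ∈ S.leftAlg) (k : K)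

theorem diagLeft_apply (Z : Al k) : diagLeft h hl k Z =
    lam (X := fun _ : K => X.double) k
      ⟨X.diag (θ Z), BBimod.diag_mem_leftAlg (h.map_mem_leftAlg (hl k Z.2))⟩ := rfl

theorem diagRight_apply (Z : Ar k) : diagRight h hr k Z =
    rho (X := fun _ : K => X.double) k
      ⟨X.diag (θ Z), BBimod.diag_mem_rightAlg (h.map_mem_rightAlg (hr k Z.2))⟩ := rfl

theorem raiseLeft_apply (Z : Ab k) : raiseLeft h hb k Z =
    lam (X := fun _ : K => X.double) k
      ⟨X.raise (θ Z), BBimod.raise_mem_leftAlg (h.map_mem_leftAlg (hb k Z Z.2))⟩ := rfl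

theorem diagLeft_L {b : B} (hbl : S.L b ∈ Al k) :
    diagLeft h hl k ⟨S.L b, hbl⟩ = (doubleProd K X).space.L b := by
  rw [diagLeft_apply, ← lam_L k b]
  congr 2
  exact BBimod.double_end_ext fun y => by
    rw [BBimod.split_diag, BBimod.space_L_apply, BBimod.split_smul, h.map_L]
    simp [Prod.smul_def]

theorem diagRight_R {b : B} (hbr : S.R b ∈ Ar k) :
    diagRight h hr k ⟨S.R b, hbr⟩ = (doubleProd K X).space.R b := by
  rw [diagRight_apply, ← rho_R k b]
  congr 2
  exact BBimod.double_end_ext fun y => by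
    rw [BBimod.split_diag, BBimod.space_R_apply, BBimod.split_op_smul, h.map_R]
    simp [Prod.smul_def]

/-- By `lam_L` the identity lives in the range of `λ_k`. It comes from `T_{L_{b₁} Z L_{b₂}} = L_{b₁}
T_Z L_{b₂}` on `𝒴_k`, which holds because `θ` respects the `L_b`. -/
theorem raiseLeft_L_mul_mul {b₁ b₂ : B} {Z Z' : Ab k} (hZ : (Z' : A) = S.L b₁ * Z * S.L b₂) :
    raiseLeft h hb k Z' =
      (doubleProd K X).space.L b₁ * raiseLeft h hb k Z * (doubleProd K X).space.L b₂ := by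
  rw [raiseLeft_apply, raiseLeft_apply, ← lam_L k b₁, ← lam_L k b₂, ← lamHom_apply,
    ← lamHom_apply, ← lamHom_apply, ← lamHom_apply, ← map_mul, ← map_mul]
  congr 1
  exact Subtype.ext <| BBimod.double_end_ext fun y => by
    simp [hZ, h.map_L, BBimod.split_smul]

theorem lowerRight_mem_leftAlg : lowerRight X k ∈ (doubleProd K X).space.leftAlg :=
  rho_mem_leftAlg k _ X.lower_mem_leftAlg

theorem lowerRight_mem_rightAlg : lowerRight X k ∈ (doubleProd K X).space.rightAlg :=
  rho_mem_rightAlg k _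

/-- A submodule invariant under all `λ_k(D_Z)` and `ρ_k(D_Z)` is invariant under the algebra they
generate. -/
theorem mem_endStabilizer_of_mem_algSet {N : Submodule ℂ (doubleProd K X).Tot}
    (hN : ∀ Z : Al k, diagLeft h hl k Z ∈ N.endStabilizer)
    (hN' : ∀ Z : Ar k, diagRight h hr k Z ∈ N.endStabilizer) {T}
    (hT : T ∈ algSet (diagLeft h hl k).range (diagRight h hr k).range) : T ∈ N.endStabilizer := by
  have : (diagLeft h hl k).range ⊔ (diagRight h hr k).range ≤ N.endStabilizer := by
    refine sup_le ?_ ?_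
    · rintro _ ⟨Z, rfl⟩
      exact hN Z
    · rintro _ ⟨Z, rfl⟩
      exact hN' Z
  exact this hT

theorem algSet_range_le_leftPart {T}
    (hT : T ∈ algSet (diagLeft h hl k).range (diagRight h hr k).range) :
    T ∈ (leftPart (X := fun _ : K => X.double) k X.firstPart).endStabilizer :=
  mem_endStabilizer_of_mem_algSet h hl hr k
    (fun _ => lam_mem_endStabilizer_leftPart _ (BBimod.diag_mem_endStabilizer_firstPart _))
    (fun _ => rho_mem_endStabilizer_leftPart _ (BBimod.diag_mem_endStabilizer_firstPart _)) hT

theorem algSet_range_le_rightPart {T}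
    (hT : T ∈ algSet (diagLeft h hl k).range (diagRight h hr k).range) :
    T ∈ (rightPart (X := fun _ : K => X.double) k X.secondPart).endStabilizer :=
  mem_endStabilizer_of_mem_algSet h hl hr k
    (fun _ => lam_mem_endStabilizer_rightPart _ (BBimod.diag_mem_endStabilizer_secondPart _))
    (fun _ => rho_mem_endStabilizer_rightPart _ (BBimod.diag_mem_endStabilizer_secondPart _)) hT

/-- The first summand of `𝒴_k = 𝒳 ⊕ 𝒳` in `𝒴`. -/
noncomputable def firstIncl (X : BBimod.{u, w} B) (k : K) : Submodule ℂ (doubleProd K X).Tot :=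
  X.firstPart.map (incl (X := fun _ : K => X.double) k)

/-- The second summand of `𝒴_k = 𝒳 ⊕ 𝒳` in `𝒴`. -/
noncomputable def secondIncl (X : BBimod.{u, w} B) (k : K) : Submodule ℂ (doubleProd K X).Tot :=
  X.secondPart.map (incl (X := fun _ : K => X.double) k)

theorem algSet_range_le_firstIncl {T}
    (hT : T ∈ algSet (diagLeft h hl k).range (diagRight h hr k).range) :
    T ∈ (firstIncl X k).endStabilizer :=
  mem_endStabilizer_of_mem_algSet h hl hr k
    (fun _ => lam_mem_endStabilizer_map _ (BBimod.diag_mem_endStabilizer_firstPart _))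
    (fun _ => rho_mem_endStabilizer_map _ (BBimod.diag_mem_endStabilizer_firstPart _)) hT

theorem algSet_range_le_secondIncl {T}
    (hT : T ∈ algSet (diagLeft h hl k).range (diagRight h hr k).range) :
    T ∈ (secondIncl X k).endStabilizer :=
  mem_endStabilizer_of_mem_algSet h hl hr k
    (fun _ => lam_mem_endStabilizer_map _ (BBimod.diag_mem_endStabilizer_secondPart _))
    (fun _ => rho_mem_endStabilizer_map _ (BBimod.diag_mem_endStabilizer_secondPart _)) hT

theorem one_mem_firstIncl : ((1, 0) : (doubleProd K X).Tot) ∈ firstIncl X k :=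
  ⟨(1, 0), BBimod.one_mem_firstPart, by ext <;> simp [incl, mk_zero_cons]⟩

theorem fst_eq_zero_of_mem_secondIncl {v : (doubleProd K X).Tot} (hv : v ∈ secondIncl X k) :
    v.1 = 0 := by
  obtain ⟨y, hy, rfl⟩ := hv
  exact BBimod.fst_eq_zero_of_mem_secondPart hy

theorem raiseLeft_eq_zero (Z : Ab k) {v : (doubleProd K X).Tot} (hv : v ∈ firstIncl X k) :
    raiseLeft h hb k Z v = 0 := by
  obtain ⟨y, hy, rfl⟩ := hv
  rw [raiseLeft_apply, lam_incl, BBimod.raise_eq_zero _ hy, map_zero]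

theorem raiseLeft_mem_firstIncl (Z : Ab k) {v : (doubleProd K X).Tot}
    (hv : v ∈ secondIncl X k) : raiseLeft h hb k Z v ∈ firstIncl X k := by
  obtain ⟨y, hy, rfl⟩ := hv
  rw [raiseLeft_apply, lam_incl]
  exact ⟨_, BBimod.raise_mem_firstPart _ _, rfl⟩

theorem lowerRight_mem_secondIncl {v : (doubleProd K X).Tot} (hv : v ∈ firstIncl X k) :
    lowerRight X k v ∈ secondIncl X k := by
  obtain ⟨y, hy, rfl⟩ := hv
  rw [lowerRight, rho_incl]
  exact ⟨_, BBimod.lower_mem_secondPart _, rfl⟩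

theorem range_diagLeft_le :
    (diagLeft h hl k).range ≤ (lamHom (X := fun _ : K => X.double) k).range :=
  AlgHom.range_comp_le_range _ _

theorem range_diagRight_le :
    (diagRight h hr k).range ≤ (rhoHom (X := fun _ : K => X.double) k).range :=
  AlgHom.range_comp_le_range _ _

theorem isPair_range (hT : S.IsPair (Al k) (Ar k)) :
    (doubleProd K X).space.IsPair (diagLeft h hl k).range (diagRight h hr k).range :=
  ⟨⟨fun b => ⟨⟨_, hT.1.1 b⟩, diagLeft_L h hl k (hT.1.1 b)⟩,
    (range_diagLeft_le h hl k).trans (range_lamHom_le_leftAlg k)⟩,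
    fun b => ⟨⟨_, hT.2.1 b⟩, diagRight_R h hr k (hT.2.1 b)⟩,
    (range_diagRight_le h hr k).trans (range_rhoHom_le_rightAlg k)⟩

/-- The right-hand operator leaves the left tensor factor in the first summand of `𝒳 ⊕ 𝒳`, the
middle one keeps it there, and the left-hand operator kills it. -/
theorem raiseLeft_mul_mul_raiseLeft (Z Z' : Ab k) {T}
    (hT : T ∈ algSet (diagLeft h hl k).range (diagRight h hr k).range) :
    raiseLeft h hb k Z * T * raiseLeft h hb k Z' = 0 := by
  refine LinearMap.ext fun v => ?_
  have h₁ : raiseLeft h hb k Z' v ∈ leftPart (X := fun _ : K => X.double) k X.firstPart := by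
    rw [raiseLeft_apply]
    exact lam_apply_mem_leftPart (X := fun _ : K => X.double) _
      (fun x => BBimod.raise_mem_firstPart _ x) v
  have h₂ := algSet_range_le_leftPart h hl hr k hT _ h₁
  rw [Module.End.mul_apply, Module.End.mul_apply, LinearMap.zero_apply, raiseLeft_apply]
  exact lam_eq_zero_of_mem_leftPart (X := fun _ : K => X.double) _
      (fun x hx => BBimod.raise_eq_zero _ hx) h₂

/-- The mirror image: `ρ_k(S)` puts the right tensor factor in the second summand, which `𝔸`
preserves and `S` kills. -/
theorem lowerRight_mul_mul_lowerRight {T}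
    (hT : T ∈ algSet (diagLeft h hl k).range (diagRight h hr k).range) :
    lowerRight X k * T * lowerRight X k = 0 := by
  refine LinearMap.ext fun v => ?_
  have h₁ : lowerRight X k v ∈ rightPart (X := fun _ : K => X.double) k X.secondPart := by
    rw [lowerRight]
    exact rho_apply_mem_rightPart (X := fun _ : K => X.double) _
      (fun x => BBimod.lower_mem_secondPart x) v
  have h₂ := algSet_range_le_rightPart h hl hr k hT _ h₁
  rw [Module.End.mul_apply, Module.End.mul_apply, LinearMap.zero_apply]
  exact rho_eq_zero_of_mem_rightPart (X := fun _ : K => X.double) _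
      (fun x hx => BBimod.lower_eq_zero hx) h₂

/-- Starting from `1`, the rightmost `𝔸` stays in the first summand of `𝒴_k`, on which every
`λ_k(T_Z)` vanishes. For `n = 0` it is the isolated factor from `C'` that kills the vector. -/
theorem E_eq_zero_of_mem_raise (n : ℕ) {T}
    (hT : T ∈ algSet (diagLeft h hl k).range (diagRight h hr k).range *
      Set.range (raiseLeft h hb k) * algSet (diagLeft h hl k).range (diagRight h hr k).range *
      ({lowerRight X k} * algSet (diagLeft h hl k).range (diagRight h hr k).range *
        Set.range (raiseLeft h hb k)) ^ n *
      algSet (diagLeft h hl k).range (diagRight h hr k).range) :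
    (doubleProd K X).space.E T = 0 := by
  have hw : ∀ n : ℕ, ∀ T ∈ ({lowerRight X k} *
      algSet (diagLeft h hl k).range (diagRight h hr k).range *
        Set.range (raiseLeft h hb k)) ^ n, T ∈ (firstIncl X k).endStabilizer := by
    intro n
    induction n with
    | zero =>
      rintro _ rfl
      exact one_mem _
    | succ n ih =>
      rw [pow_succ]
      rintro _ ⟨T, hT, _, ⟨R, -, _, ⟨Z, rfl⟩, rfl⟩, rfl⟩
      -- Each block `D' 𝔸 C'` is zero on the first summand, hence leaves it invariant. Invariance,
      -- unlike vanishing, also covers the empty power.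
      refine mul_mem (ih T hT) fun v hv => ?_
      rw [Module.End.mul_apply, raiseLeft_eq_zero h hb k Z hv, map_zero]
      exact zero_mem _
  obtain ⟨_, ⟨_, ⟨_, ⟨R, -, _, ⟨Z, rfl⟩, rfl⟩, R', hR', rfl⟩, T, hT, rfl⟩, R'', hR'', rfl⟩ := hT
  have h₁ := algSet_range_le_firstIncl h hl hr k hR' _ (hw n T hT _
    (algSet_range_le_firstIncl h hl hr k hR'' _ (one_mem_firstIncl k)))
  simp only [BBimod.space_E_apply, Module.End.mul_apply]
  rw [raiseLeft_eq_zero h hb k Z h₁, map_zero, Prod.fst_zero]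

/-- A block `C' 𝔸 D'` goes from the first summand to the second and back. The remaining factor from
`D'` leaves the vector in the second summand, where the `B`-component is zero. -/
theorem E_eq_zero_of_mem_lower (n : ℕ) {T}
    (hT : T ∈ algSet (diagLeft h hl k).range (diagRight h hr k).range *
      {lowerRight X k} * algSet (diagLeft h hl k).range (diagRight h hr k).range *
      (Set.range (raiseLeft h hb k) * algSet (diagLeft h hl k).range (diagRight h hr k).range *
        {lowerRight X k}) ^ n *
      algSet (diagLeft h hl k).range (diagRight h hr k).range) :
    (doubleProd K X).space.E T = 0 := by
  have hw : ∀ n : ℕ, ∀ T ∈ (Set.range (raiseLeft h hb k) *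
      algSet (diagLeft h hl k).range (diagRight h hr k).range *
        {lowerRight X k}) ^ n, T ∈ (firstIncl X k).endStabilizer := by
    intro n
    induction n with
    | zero =>
      rintro _ rfl
      exact one_mem _
    | succ n ih =>
      rw [pow_succ]
      rintro _ ⟨T, hT, _, ⟨_, ⟨_, ⟨Z, rfl⟩, R, hR, rfl⟩, _, rfl, rfl⟩, rfl⟩
      exact mul_mem (ih T hT) fun v hv => raiseLeft_mem_firstIncl h hb k Z
        (algSet_range_le_secondIncl h hl hr k hR _ (lowerRight_mem_secondIncl k hv))
  obtain ⟨_, ⟨_, ⟨_, ⟨R, hR, _, rfl, rfl⟩, R', hR', rfl⟩, T, hT, rfl⟩, R'', hR'', rfl⟩ := hT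
  exact fst_eq_zero_of_mem_secondIncl k (algSet_range_le_secondIncl h hl hr k hR _
    (lowerRight_mem_secondIncl k (algSet_range_le_firstIncl h hl hr k hR' _ (hw n T hT _
      (algSet_range_le_firstIncl h hl hr k hR'' _ (one_mem_firstIncl k))))))

end

theorem isFFBSystem_double (h : S.IsRep X θ) (hT : ∀ k, S.IsTriple (Al k) (Ar k) (Ab k)) :
    IsFFBSystem.{u, max u t w, max u w, t} (doubleProd K X).space
      (fun k => (diagLeft h (fun k => (hT k).1.1.2) k).range)
      (fun k => (diagRight h (fun k => (hT k).1.2.2) k).range)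
      (fun k => Set.range (raiseLeft h (fun k => (hT k).2.2) k)) (fun k => {lowerRight X k}) := by
  have hl : ∀ k, Al k ≤ S.leftAlg := fun k => (hT k).1.1.2
  have hr : ∀ k, Ar k ≤ S.rightAlg := fun k => (hT k).1.2.2
  have hb : ∀ k, ∀ d ∈ Ab k, d ∈ S.leftAlg := fun k => (hT k).2.2
  have hp (k) := isPair_range h hl hr k (hT k).1
  have hC (k) : Algebra.adjoin ℂ (((diagLeft h hl k).range : Set _) ∪
      (lamHom (X := fun _ : K => X.double) k).range.toNonUnitalSubalgebra) ≤
      (lamHom (X := fun _ : K => X.double) k).range :=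
    Algebra.adjoin_le (Set.union_subset (range_diagLeft_le h hl k) subset_rfl)
  have hD (k) : Algebra.adjoin ℂ (((diagRight h hr k).range : Set _) ∪
      (rhoHom (X := fun _ : K => X.double) k).range.toNonUnitalSubalgebra) ≤
      (rhoHom (X := fun _ : K => X.double) k).range :=
    Algebra.adjoin_le (Set.union_subset (range_diagRight_le h hr k) subset_rfl)
  -- The ambient algebras `C_k` and `D_k` are the full ranges of `λ_k` and `ρ_k`, so the generated
  -- algebras stay inside these ranges and `isBiFree_of_le_range` applies.
  refine ⟨hp, ⟨fun k => (lamHom k).range.toNonUnitalSubalgebra,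
    fun k => (rhoHom k).range.toNonUnitalSubalgebra, ?_, fun k => ⟨?_, ?_, ?_⟩⟩, ?_, ?_⟩
  · refine isBiFree_of_le_range (fun k => (hp k).mono ?_ ?_ ?_ ?_) hC hD
    · exact fun T hT => Algebra.subset_adjoin (Set.mem_union_left _ hT)
    · exact (hC k).trans (range_lamHom_le_leftAlg k)
    · exact fun T hT => Algebra.subset_adjoin (Set.mem_union_left _ hT)
    · exact (hD k).trans (range_rhoHom_le_rightAlg k)
  · rintro _ ⟨Z, rfl⟩
    exact ⟨_, rfl⟩
  · rintro _ rfl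
    exact ⟨_, rfl⟩
  · rintro _ rfl
    exact lowerRight_mem_leftAlg k
  · rintro k b _ ⟨Z, rfl⟩
    -- The Boolean face is closed under two-sided multiplication, so one-sided closure takes `L_1 =
    -- 1` on the other side.
    refine ⟨⟨⟨S.L b * Z * S.L 1, (hT k).2.1 b 1 Z Z.2⟩, ?_⟩,
      ⟨⟨S.L 1 * Z * S.L b, (hT k).2.1 1 b Z Z.2⟩, ?_⟩⟩
    · rw [raiseLeft_L_mul_mul h hb k (b₁ := b) (b₂ := 1) (Z := Z) rfl, L_one, mul_one]
    · rw [raiseLeft_L_mul_mul h hb k (b₁ := 1) (b₂ := b) (Z := Z) rfl, L_one, one_mul]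
  · intro k 𝔸
    have h0 : (0 : Module.End ℂ (doubleProd K X).Tot) ∈ 𝔸 :=
      ((diagLeft h hl k).range ⊔ (diagRight h hr k).range).zero_mem
    refine ⟨Set.Subset.antisymm ?_ ?_, Set.Subset.antisymm ?_ ?_,
      fun n T => E_eq_zero_of_mem_raise h hl hr hb k n,
      fun n T => E_eq_zero_of_mem_lower h hl hr hb k n⟩
    · rintro _ ⟨_, ⟨_, ⟨Z, rfl⟩, T, hT', rfl⟩, _, ⟨Z', rfl⟩, rfl⟩
      exact raiseLeft_mul_mul_raiseLeft h hl hr hb k Z Z' hT'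
    -- Equality with `{0}` also asks that the product set be nonempty; here `0 = λ_k(T_0)` provides
    -- an element.
    · rw [Set.singleton_subset_iff, ← zero_mul (0 : Module.End ℂ (doubleProd K X).Tot)]
      refine Set.mul_mem_mul ?_ ⟨0, map_zero _⟩
      rw [← mul_zero (0 : Module.End ℂ (doubleProd K X).Tot)]
      exact Set.mul_mem_mul ⟨0, map_zero _⟩ h0
    · rintro _ ⟨_, ⟨_, rfl, T, hT', rfl⟩, _, rfl, rfl⟩
      exact lowerRight_mul_mul_lowerRight h hl hr k hT'
    · rw [Set.singleton_subset_iff, ← zero_mul (lowerRight X k)]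
      refine Set.mul_mem_mul ?_ rfl
      rw [← mul_zero (lowerRight X k)]
      exact Set.mul_mem_mul rfl h0

end NCPS

/-! ### A faithful representation. -/

namespace NCPS

variable {B : Type u} [Ring B] [Algebra ℂ B] {A : Type v} [Ring A] [Algebra ℂ A] (S : NCPS B A)

section kernel

variable {W : Type w} [AddCommGroup W] [Module ℂ W] [Module A W] [IsScalarTower ℂ A W]

/-- A linear functional on an `A`-module with values in `B` that is a `B`-`B`-bimodule map. -/
def IsBimodMap (F : W →ₗ[ℂ] B) : Prop :=
  ∀ (b : B) (c : Bᵐᵒᵖ) w, F (S.ε (b ⊗ₜ[ℂ] c) • w) = b * F w * c.unop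

/-- The kernel of a `B`-`B`-bimodule map on an `A`-module. -/
noncomputable def kerBimod (F : W →ₗ[ℂ] B) (hF : S.IsBimodMap F) : BBimod.{u, w} B :=
  letI : SMul B (LinearMap.ker F) := ⟨fun b x => ⟨S.ε (b ⊗ₜ[ℂ] 1) • (x : W), by simp [hF b 1]⟩⟩
  letI : SMul Bᵐᵒᵖ (LinearMap.ker F) :=
    ⟨fun b x => ⟨S.ε (1 ⊗ₜ[ℂ] b) • (x : W), by simp [hF 1 b]⟩⟩
  have hl : ∀ (b : B) (x : LinearMap.ker F), ((b • x : LinearMap.ker F) : W) =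
    S.ε (b ⊗ₜ[ℂ] 1) • (x : W) := fun _ _ => rfl
  have hr : ∀ (b : Bᵐᵒᵖ) (x : LinearMap.ker F), ((b • x : LinearMap.ker F) : W) =
    S.ε (1 ⊗ₜ[ℂ] b) • (x : W) := fun _ _ => rfl
  letI : Module B (LinearMap.ker F) :=
    { one_smul := fun x => Subtype.ext <| by
        rw [hl, ← Algebra.TensorProduct.one_def, map_one, one_smul]
      mul_smul := fun b c x => Subtype.ext <| by
        rw [hl, hl, hl, smul_smul, ← map_mul, Algebra.TensorProduct.tmul_mul_tmul, one_mul]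
      smul_zero := fun b => Subtype.ext <| by simp [hl]
      smul_add := fun b x y => Subtype.ext <| by simp [hl]
      add_smul := fun b c x => Subtype.ext <| by simp [hl, TensorProduct.add_tmul, add_smul]
      zero_smul := fun x => Subtype.ext <| by simp [hl] }
  letI : Module Bᵐᵒᵖ (LinearMap.ker F) :=
    { one_smul := fun x => Subtype.ext <| by
        rw [hr, ← Algebra.TensorProduct.one_def, map_one, one_smul]
      mul_smul := fun b c x => Subtype.ext <| by
        rw [hr, hr, hr, smul_smul, ← map_mul, Algebra.TensorProduct.tmul_mul_tmul, one_mul]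
      smul_zero := fun b => Subtype.ext <| by simp [hr]
      smul_add := fun b x y => Subtype.ext <| by simp [hr]
      add_smul := fun b c x => Subtype.ext <| by simp [hr, TensorProduct.tmul_add, add_smul]
      zero_smul := fun x => Subtype.ext <| by simp [hr] }
  { carrier := LinearMap.ker F
    comm := ⟨fun b c x => Subtype.ext <| by
      rw [hl, hr, hr, hl, smul_smul, smul_smul, ← map_mul, ← map_mul]
      simp⟩
    towerL := ⟨fun c b x => Subtype.ext <| by
      simp [hl, ← TensorProduct.smul_tmul', smul_assoc]⟩
    towerR := ⟨fun c b x => Subtype.ext <| by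
      simp [hr, smul_assoc]⟩ }

variable {S} {F : W →ₗ[ℂ] B} (hF : S.IsBimodMap F)

/-- An element of the bimodule `ker F`, as an element of the ambient module. -/
noncomputable def kerBimodVal : (S.kerBimod F hF).carrier →ₗ[ℂ] W := (LinearMap.ker F).subtype

theorem kerBimodVal_injective : Function.Injective (kerBimodVal hF) := Subtype.val_injective

theorem map_kerBimodVal (x : (S.kerBimod F hF).carrier) : F (kerBimodVal hF x) = 0 :=
  LinearMap.mem_ker.1 (x : LinearMap.ker F).2

theorem kerBimodVal_smul (b : B) (x : (S.kerBimod F hF).carrier) :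
    kerBimodVal hF (b • x) = S.ε (b ⊗ₜ[ℂ] 1) • kerBimodVal hF x := rfl

theorem kerBimodVal_op_smul (b : Bᵐᵒᵖ) (x : (S.kerBimod F hF).carrier) :
    kerBimodVal hF (b • x) = S.ε (1 ⊗ₜ[ℂ] b) • kerBimodVal hF x := rfl

/-- The map `b ⊕ x ↦ b w₀ + x` on `B ⊕ ker F`. -/
noncomputable def kerSum (w₀ : W) : (S.kerBimod F hF).Tot →ₗ[ℂ] W where
  toFun y := S.ε (y.1 ⊗ₜ[ℂ] 1) • w₀ + kerBimodVal hF y.2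
  map_add' y z := by
    simp only [Prod.fst_add, Prod.snd_add, TensorProduct.add_tmul, map_add, add_smul]
    abel
  map_smul' c y := by
    rw [Prod.smul_fst, Prod.smul_snd, map_smul, ← TensorProduct.smul_tmul', map_smul, smul_assoc,
      RingHom.id_apply, smul_add]

theorem kerSum_apply (w₀ : W) (y : (S.kerBimod F hF).Tot) :
    kerSum hF w₀ y = S.ε (y.1 ⊗ₜ[ℂ] 1) • w₀ + kerBimodVal hF y.2 := rfl

theorem map_kerSum {w₀ : W} (h₁ : F w₀ = 1) (y : (S.kerBimod F hF).Tot) :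
    F (kerSum hF w₀ y) = y.1 := by
  rw [kerSum_apply, map_add, hF, h₁, map_kerBimodVal]
  simp

/-- The splitting `B ⊕ ker F ≅ W` given by a vector `w₀` with `F w₀ = 1`. -/
noncomputable def kerSplit (w₀ : W) (h₁ : F w₀ = 1) : (S.kerBimod F hF).Tot ≃ₗ[ℂ] W :=
  LinearEquiv.ofBijective (kerSum hF w₀) <| by
    constructor
    · intro y z h
      have h₂ : y.1 = z.1 := by rw [← map_kerSum hF h₁ y, h, map_kerSum hF h₁]
      refine Prod.ext h₂ (kerBimodVal_injective hF ?_)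
      rwa [kerSum_apply, kerSum_apply, h₂, add_right_inj] at h
    -- The decomposition is `w = F(w) w₀ + (w - F(w) w₀)`; the second term is in the kernel because
    -- `F w₀ = 1`.
    · intro w
      have hw : w - S.ε (F w ⊗ₜ[ℂ] 1) • w₀ ∈ LinearMap.ker F := by simp [hF _ 1, h₁]
      exact ⟨(F w, (⟨_, hw⟩ : LinearMap.ker F)), add_sub_cancel _ w⟩

theorem kerSplit_apply (w₀ : W) (h₁ : F w₀ = 1) (y) :
    kerSplit hF w₀ h₁ y = S.ε (y.1 ⊗ₜ[ℂ] 1) • w₀ + kerBimodVal hF y.2 := rfl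

theorem fst_kerSplit_symm (w₀ : W) (h₁ : F w₀ = 1) (w : W) :
    ((kerSplit hF w₀ h₁).symm w).1 = F w := by
  obtain ⟨y, rfl⟩ := (kerSplit hF w₀ h₁).surjective w
  rw [LinearEquiv.symm_apply_apply]
  exact (map_kerSum hF h₁ y).symm

/-- The representation of `A` on `B ⊕ ker F`. -/
noncomputable def kerRep (w₀ : W) (h₁ : F w₀ = 1) :
    A →ₐ[ℂ] Module.End ℂ (S.kerBimod F hF).Tot :=
  ((kerSplit hF w₀ h₁).symm.conjAlgEquiv ℂ).toAlgHom.comp (Algebra.lsmul ℂ ℂ W)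

theorem kerRep_apply (w₀ : W) (h₁ : F w₀ = 1) (T : A) (y) : kerRep hF w₀ h₁ T y =
    (kerSplit hF w₀ h₁).symm (T • kerSplit hF w₀ h₁ y) := rfl

/-- The summand `B` corresponds to the vectors `L_b w₀`. For right multiplication by `c` on `B` to
match the action of `R_c`, one needs `R_c L_b w₀ = L_b R_c w₀ = L_b L_c w₀`, which is the role of
`hw₀`. -/
theorem isRep_kerRep (w₀ : W) (h₁ : F w₀ = 1)
    (hw₀ : ∀ b : B, S.ε (b ⊗ₜ[ℂ] 1) • w₀ = S.ε (1 ⊗ₜ[ℂ] op b) • w₀)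
    (hE : ∀ T : A, F (T • w₀) = S.E T) : S.IsRep _ (kerRep hF w₀ h₁) := by
  refine ⟨fun x => ?_, fun T => ?_⟩
  · induction x with
    | zero => simp
    | add x y hx hy => simp [hx, hy]
    | tmul b c =>
      refine LinearMap.ext fun y => ?_
      rw [kerRep_apply, LinearEquiv.symm_apply_eq]
      change _ = kerSplit hF w₀ h₁ ((S.kerBimod F hF).eps (b ⊗ₜ[ℂ] c) y)
      have h₂ : S.ε (b ⊗ₜ[ℂ] c) * S.ε (y.1 ⊗ₜ[ℂ] 1) =
          S.ε ((b * y.1) ⊗ₜ[ℂ] 1) * S.ε (1 ⊗ₜ[ℂ] op c.unop) := by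
        rw [← map_mul, ← map_mul]; simp
      have h₃ : S.ε (b ⊗ₜ[ℂ] c) = S.ε (b ⊗ₜ[ℂ] 1) * S.ε (1 ⊗ₜ[ℂ] c) := by
        rw [← map_mul]; simp
      rw [BBimod.eps_tmul_apply, kerSplit_apply, kerSplit_apply, smul_add, smul_smul, h₂, mul_smul,
        ← hw₀, smul_smul, ← map_mul, h₃]
      simp [kerBimodVal_smul, kerBimodVal_op_smul, mul_smul, mul_assoc]
  · rw [BBimod.space_E_apply, kerRep_apply, fst_kerSplit_symm, kerSplit_apply,
      ← Algebra.TensorProduct.one_def]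
    simp [hE]

theorem kerRep_injective (w₀ : W) (h₁ : F w₀ = 1)
    (hW : ∀ T T' : A, (∀ w : W, T • w = T' • w) → T = T') :
    Function.Injective (kerRep hF w₀ h₁) := fun T T' h => hW T T' fun w => by
  have := LinearMap.congr_fun h ((kerSplit hF w₀ h₁).symm w)
  simpa [kerRep_apply] using this

end kernel

/-- The left ideal of all `T` with `E (R T) = 0` for every `R`. -/
def nullIdeal : Submodule A A where
  carrier := {T | ∀ R, S.E (R * T) = 0}
  add_mem' hT hT' R := by rw [mul_add, map_add, hT, hT', add_zero]
  zero_mem' R := by simp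
  smul_mem' R' T hT R := by rw [smul_eq_mul, ← mul_assoc]; exact hT _

/-- `E` as a functional on `A / nullIdeal`. -/
noncomputable def quotE : (A ⧸ S.nullIdeal) →ₗ[ℂ] B :=
  (Submodule.liftQ (S.nullIdeal.restrictScalars ℂ) S.E fun T hT => by
      simpa using (show T ∈ S.nullIdeal from hT) 1) ∘ₗ
    (Submodule.Quotient.restrictScalarsEquiv ℂ S.nullIdeal).symm.toLinearMap

/-- A `B`-`B`-non-commutative probability space with `E 1 = 1` has a faithful representation. -/
theorem exists_isRep_injective (h₁ : S.E 1 = 1) :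
    ∃ (X : BBimod.{u, v} B) (θ : A →ₐ[ℂ] Module.End ℂ X.Tot), S.IsRep X θ ∧
      Function.Injective θ := by
  -- The functional ignores the summand `A`, so adding it changes no expectation at `w₀ = ([1], 0)`,
  -- while the action on it is faithful.
  let F : ((A ⧸ S.nullIdeal) × A) →ₗ[ℂ] B := S.quotE ∘ₗ LinearMap.fst ℂ _ _
  have hF : S.IsBimodMap F := by
    rintro b c ⟨q, a⟩
    obtain ⟨T, rfl⟩ := Submodule.Quotient.mk_surjective _ q
    exact S.E_bimod b c.unop T
  have hF₁ : F (Submodule.Quotient.mk 1, 0) = 1 := h₁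
  refine ⟨S.kerBimod F hF, kerRep hF (Submodule.Quotient.mk 1, 0) hF₁,
    isRep_kerRep hF _ hF₁ (fun b => ?_) (fun T => ?_),
    kerRep_injective hF _ hF₁ fun T T' h => ?_⟩
  · refine Prod.ext ?_ (by simp)
    change (Submodule.Quotient.mk (S.ε (b ⊗ₜ[ℂ] 1) * 1) : A ⧸ S.nullIdeal) =
      Submodule.Quotient.mk (S.ε (1 ⊗ₜ[ℂ] op b) * 1)
    rw [Submodule.Quotient.eq, mul_one, mul_one]
    intro R
    -- The axiom `E (T L_b) = E (T R_b)` says exactly that `L_b - R_b` lies in the left ideal.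
    rw [mul_sub, map_sub, S.E_right, sub_self]
  · change S.E (T * 1) = S.E T
    rw [mul_one]
  · simpa using congrArg Prod.snd (h (0, 1))

end NCPS

/-! ### Moments, injectivity and the assembled construction. -/

namespace NCPS

open RedFree

variable {B : Type u} [Ring B] [Algebra ℂ B] {A : Type v} [Ring A] [Algebra ℂ A] {K : Type t}
  {S : NCPS B A} {Al Ar : K → Subalgebra ℂ A} {Ab : K → NonUnitalSubalgebra ℂ A}
  {X : BBimod.{u, w} B} {θ : A →ₐ[ℂ] Module.End ℂ X.Tot}

/-- A vector of `𝒳` as a vector of the first summand of `𝒴_k = 𝒳 ⊕ 𝒳` in `𝒴`. -/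
noncomputable def embFirst (X : BBimod.{u, w} B) (k : K) (x : X.Tot) : (doubleProd K X).Tot :=
  incl (X := fun _ : K => X.double) k (X.split.symm (x, 0))

theorem fst_embFirst (k : K) (x : X.Tot) : (embFirst X k x).1 = x.1 := rfl

theorem embFirst_one (k : K) : embFirst X k (1, 0) = (1, 0) :=
  Prod.ext rfl (mk_zero_cons (X := fun _ : K => X.double) [] k)

theorem embFirst_injective (k : K) : Function.Injective (embFirst X k) := fun x y h => by
  simpa using X.split.symm.injective (incl_injective (X := fun _ : K => X.double) k h)

section

variable (h : S.IsRep X θ) (hl : ∀ k, Al k ≤ S.leftAlg) (hr : ∀ k, Ar k ≤ S.rightAlg)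
  (hb : ∀ k, ∀ d ∈ Ab k, d ∈ S.leftAlg) (k : K)

theorem diagLeft_embFirst (Z : Al k) (x : X.Tot) :
    diagLeft h hl k Z (embFirst X k x) = embFirst X k (θ Z x) := by
  rw [diagLeft_apply, embFirst, lam_incl, embFirst]
  congr 1
  exact X.split.injective (by simp)

theorem diagRight_embFirst (Z : Ar k) (x : X.Tot) :
    diagRight h hr k Z (embFirst X k x) = embFirst X k (θ Z x) := by
  rw [diagRight_apply, embFirst, rho_incl, embFirst]
  congr 1
  exact X.split.injective (by simp)

/-- On `𝒴_k` both representations reduce to the given operators: `S` moves `x` to the second copy of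
`𝒳`, and `T_Z` brings it back as `θ(Z) x`. -/
theorem raiseLeft_mul_lowerRight_embFirst (Z : Ab k) (x : X.Tot) :
    (raiseLeft h hb k Z * lowerRight X k) (embFirst X k x) = embFirst X k (θ Z x) := by
  rw [Module.End.mul_apply, raiseLeft_apply, lowerRight, embFirst, rho_incl, lam_incl, embFirst]
  exact congrArg _ (X.split.injective (by simp))

/-- `Z ↦ λ_k(T_Z) ρ_k(S)`. -/
noncomputable def raiseLower :
    Ab k →ₗ[ℂ] NonUnitalAlgebra.adjoin ℂ (Set.range (raiseLeft h hb k) * {lowerRight X k}) where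
  toFun Z := ⟨raiseLeft h hb k Z * lowerRight X k,
    NonUnitalAlgebra.subset_adjoin ℂ (Set.mul_mem_mul ⟨Z, rfl⟩ rfl)⟩
  map_add' Z Z' := Subtype.ext <|
    (congrArg (· * lowerRight X k) (map_add (raiseLeft h hb k) Z Z')).trans (add_mul _ _ _)
  map_smul' c Z := Subtype.ext <|
    (congrArg (· * lowerRight X k) (map_smul (raiseLeft h hb k) c Z)).trans (smul_mul_assoc _ _ _)

theorem coe_raiseLower (Z : Ab k) :
    (raiseLower h hb k Z : Module.End ℂ (doubleProd K X).Tot) =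
      raiseLeft h hb k Z * lowerRight X k := rfl

/-- The copy of `𝒳` is invariant under every generator, each acting on it as its `θ(Z)`; hence a
whole word acts as `θ` of the product. -/
theorem prod_map_embFirst (z : List (Al k ⊕ Ar k ⊕ Ab k)) (x : X.Tot) :
    (z.map (Sum.elim (fun Z => diagLeft h hl k Z) (Sum.elim (fun Z => diagRight h hr k Z)
      (fun Z => raiseLeft h hb k Z * lowerRight X k)))).prod (embFirst X k x) =
    embFirst X k (θ (z.map (Sum.elim (fun Z : Al k => (Z : A))
      (Sum.elim (fun Z : Ar k => (Z : A)) (fun Z : Ab k => (Z : A))))).prod x) := by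
  induction z with
  | nil => simp
  | cons a z ih =>
    rw [List.map_cons, List.prod_cons, List.map_cons, List.prod_cons, Module.End.mul_apply, ih,
      map_mul, Module.End.mul_apply]
    rcases a with Z | Z | Z
    · exact diagLeft_embFirst h hl k Z _
    · exact diagRight_embFirst h hr k Z _
    · exact raiseLeft_mul_lowerRight_embFirst h hb k Z _

/-- An operator that restricts to `θ (g i)` on the embedded copy of `𝒳` determines `θ (g i)`. -/
theorem injective_of_embFirst {ι : Type*} {f : ι → Module.End ℂ (doubleProd K X).Tot} {g : ι → A}
    (hg : Function.Injective fun i => θ (g i))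
    (hfg : ∀ i x, f i (embFirst X k x) = embFirst X k (θ (g i) x)) :
    Function.Injective f := fun i j hij => hg <| LinearMap.ext fun x => embFirst_injective k <| by
  rw [← hfg, ← hfg, hij]

end

theorem isFFBEmbedding_double (h : S.IsRep X θ) (hT : ∀ k, S.IsTriple (Al k) (Ar k) (Ab k)) :
    IsFFBEmbedding.{u, v, max u w, t} S (doubleProd K X).space Al Ar Ab
      (fun k => (diagLeft h (fun k => (hT k).1.1.2) k).range)
      (fun k => (diagRight h (fun k => (hT k).1.2.2) k).range)
      (fun k => Set.range (raiseLeft h (fun k => (hT k).2.2) k)) (fun k => {lowerRight X k})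
      (fun k => (diagLeft h (fun k => (hT k).1.1.2) k).rangeRestrict.toLinearMap)
      (fun k => (diagRight h (fun k => (hT k).1.2.2) k).rangeRestrict.toLinearMap)
      (raiseLower h fun k => (hT k).2.2) where
  system := isFFBSystem_double h hT
  linear_l k b₁ b₂ Z Z' hZ := by
    have hL := (hT k).1.1.1
    have e : Z' = ⟨S.L b₁, hL b₁⟩ * Z * ⟨S.L b₂, hL b₂⟩ := Subtype.ext hZ
    change diagLeft h (fun k => (hT k).1.1.2) k Z' = _ * diagLeft h (fun k => (hT k).1.1.2) k Z * _
    rw [e, map_mul, map_mul, diagLeft_L, diagLeft_L]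
  linear_r k b₁ b₂ Z Z' hZ := by
    have hR := (hT k).1.2.1
    have e : Z' = ⟨S.R b₁, hR b₁⟩ * Z * ⟨S.R b₂, hR b₂⟩ := Subtype.ext hZ
    change diagRight h (fun k => (hT k).1.2.2) k Z' =
      _ * diagRight h (fun k => (hT k).1.2.2) k Z * _
    rw [e, map_mul, map_mul, diagRight_R, diagRight_R]
  linear_b k b₁ b₂ Z Z' hZ := by
    -- The rightmost `L_{b₂}` must pass `ρ_k(S)`, which commutes with it because `S` is left
    -- `B`-linear.
    have hc := (Subalgebra.mem_centralizer_iff ℂ).1 (lowerRight_mem_rightAlg (X := X) k) _ ⟨b₂, rfl⟩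
    rw [coe_raiseLower, coe_raiseLower, raiseLeft_L_mul_mul h (fun k => (hT k).2.2) k hZ]
    simp only [mul_assoc, hc]
  moments k z := by
    -- Evaluated at `1`, which the embedding sends to `1`, and compared in the `B`-component, which
    -- the embedding keeps.
    have := congrArg Prod.fst (prod_map_embFirst h (fun k => (hT k).1.1.2)
      (fun k => (hT k).1.2.2) (fun k => (hT k).2.2) k z (1, 0))
    rw [fst_embFirst, embFirst_one] at this
    rw [← h.2]
    exact this

theorem isConstruction_double (h : S.IsRep X θ) (hT : ∀ k, S.IsTriple (Al k) (Ar k) (Ab k)) :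
    IsConstruction X θ Al Ar Ab
      (fun k => (diagLeft h (fun k => (hT k).1.1.2) k).range)
      (fun k => (diagRight h (fun k => (hT k).1.2.2) k).range)
      (fun k => Set.range (raiseLeft h (fun k => (hT k).2.2) k)) (fun k => {lowerRight X k})
      (fun k => (diagLeft h (fun k => (hT k).1.1.2) k).rangeRestrict.toLinearMap)
      (fun k => (diagRight h (fun k => (hT k).1.2.2) k).rangeRestrict.toLinearMap)
      (raiseLower h fun k => (hT k).2.2) where
  map_l _ _ := ⟨_, rfl⟩
  map_r _ _ := ⟨_, rfl⟩
  map_b _ _ := ⟨_, _, rfl⟩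
  surj_l k := (diagLeft h (fun k => (hT k).1.1.2) k).rangeRestrict_surjective
  surj_r k := (diagRight h (fun k => (hT k).1.2.2) k).rangeRestrict_surjective
  C'_eq k := by
    ext T
    constructor
    · rintro ⟨Z, rfl⟩
      exact ⟨Z, Z.2, _, rfl⟩
    · rintro ⟨Z, hZ, _, rfl⟩
      exact ⟨⟨Z, hZ⟩, rfl⟩
  D'_eq k := by
    ext T
    constructor
    · rintro rfl
      exact ⟨_, rfl⟩
    · rintro ⟨_, rfl⟩
      rfl

theorem injective_double (h : S.IsRep X θ) (hT : ∀ k, S.IsTriple (Al k) (Ar k) (Ab k)) (k : K) :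
    (Set.InjOn θ (Al k) → Function.Injective
      (diagLeft h (fun k => (hT k).1.1.2) k).rangeRestrict.toLinearMap) ∧
    (Set.InjOn θ (Ar k) → Function.Injective
      (diagRight h (fun k => (hT k).1.2.2) k).rangeRestrict.toLinearMap) ∧
    (Set.InjOn θ (Ab k) → Function.Injective (raiseLower h (fun k => (hT k).2.2) k)) := by
  refine ⟨fun hi => ?_, fun hi => ?_, fun hi => ?_⟩
  · exact .of_comp (f := Subtype.val) (injective_of_embFirst k (Set.injOn_iff_injective.1 hi)
      (diagLeft_embFirst h (fun k => (hT k).1.1.2) k))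
  · exact .of_comp (f := Subtype.val) (injective_of_embFirst k (Set.injOn_iff_injective.1 hi)
      (diagRight_embFirst h (fun k => (hT k).1.2.2) k))
  · exact .of_comp (f := Subtype.val) (injective_of_embFirst k (Set.injOn_iff_injective.1 hi)
      (raiseLeft_mul_lowerRight_embFirst h (fun k => (hT k).2.2) k))

/-- The empty word is among the joint moments, and in the free product its expectation is the
`B`-component of the vector `1`. -/
theorem IsFFB.E_one (h : IsFFB.{u, v, w, t} S Al Ar Ab) : S.E 1 = 1 := by
  obtain ⟨-, _, _, _, _, h⟩ := h
  exact h []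

end NCPS

theorem mainTheorem4 {B : Type u} [Ring B] [Algebra ℂ B] {A : Type v} [Ring A] [Algebra ℂ A]
    {K : Type t} (S : NCPS B A) (Al Ar : K → Subalgebra ℂ A) (Ab : K → NonUnitalSubalgebra ℂ A)
    (h : NCPS.IsFFB.{u, v, w, t} S Al Ar Ab) :
    (∃ (X : BBimod.{u, v} B) (θ : A →ₐ[ℂ] Module.End ℂ X.Tot), S.IsRep X θ ∧
      ∃ (Atl Atr : K → Subalgebra ℂ (Module.End ℂ (RedFree.prod fun _ : K => X.double).Tot))
        (C' D' : K → Set (Module.End ℂ (RedFree.prod fun _ : K => X.double).Tot))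
        (αl : ∀ k, Al k →ₗ[ℂ] Atl k) (αr : ∀ k, Ar k →ₗ[ℂ] Atr k)
        (αb : ∀ k, Ab k →ₗ[ℂ] NonUnitalAlgebra.adjoin ℂ (C' k * D' k)),
        NCPS.IsFFBEmbedding.{u, v, max u v, t} S (RedFree.prod fun _ : K => X.double).space Al Ar Ab
          Atl Atr C' D' αl αr αb ∧
        (∀ k, Function.Injective (αl k) ∧ Function.Injective (αr k) ∧
          Function.Injective (αb k)) ∧
        NCPS.IsConstruction X θ Al Ar Ab Atl Atr C' D' αl αr αb) ∧
    ∀ (X : BBimod.{u, s} B) (θ : A →ₐ[ℂ] Module.End ℂ X.Tot), S.IsRep X θ →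
      ∃ (Atl Atr : K → Subalgebra ℂ (Module.End ℂ (RedFree.prod fun _ : K => X.double).Tot))
        (C' D' : K → Set (Module.End ℂ (RedFree.prod fun _ : K => X.double).Tot))
        (αl : ∀ k, Al k →ₗ[ℂ] Atl k) (αr : ∀ k, Ar k →ₗ[ℂ] Atr k)
        (αb : ∀ k, Ab k →ₗ[ℂ] NonUnitalAlgebra.adjoin ℂ (C' k * D' k)),
        NCPS.IsFFBEmbedding.{u, v, max u s, t} S (RedFree.prod fun _ : K => X.double).space Al Ar Ab
          Atl Atr C' D' αl αr αb ∧
        (∀ k, (Set.InjOn θ (Al k) → Function.Injective (αl k)) ∧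
          (Set.InjOn θ (Ar k) → Function.Injective (αr k)) ∧
          (Set.InjOn θ (Ab k) → Function.Injective (αb k))) ∧
        NCPS.IsConstruction X θ Al Ar Ab Atl Atr C' D' αl αr αb := by
  constructor
  · obtain ⟨X, θ, hX, hθ⟩ := S.exists_isRep_injective h.E_one
    have hi := NCPS.injective_double hX h.1
    exact ⟨X, θ, hX, _, _, _, _, _, _, _, NCPS.isFFBEmbedding_double hX h.1,
      fun k => ⟨(hi k).1 hθ.injOn, (hi k).2.1 hθ.injOn, (hi k).2.2 hθ.injOn⟩,
      NCPS.isConstruction_double hX h.1⟩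
  · intro X θ hX
    exact ⟨_, _, _, _, _, _, _, NCPS.isFFBEmbedding_double hX h.1, NCPS.injective_double hX h.1,
      NCPS.isConstruction_double hX h.1⟩
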